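/- Let $\Sigma$ be an oriented smooth ($C^\infty$) surface. A fundamental pair $(I,II)$ on $\Sigma$ consists of a smooth Riemannian metric $I$ and a smooth real quadratic form $II$; its shape operator $S$ is defined by $II(X,Y)=I(SX,Y)$, its mean curvature is $H(I,II)=\tfrac12\operatorname{tr}S$ and its extrinsic curvature is $K(I,II)=\det S$. The pair is a Codazzi pair if $\nabla_XSY-\nabla_YSX-S[X,Y]=0$ for all smooth vector fields $X,Y$, where $\nabla$ is the Levi-Civita connection of $I$. The Hopf differential of $(I,II)$ is the $(2,0)$-part of $II$ for the Riemann surface structure on $\Sigma$ induced by $I$ and the orientation. Let $(I,II)$ be a Codazzi pair on $\Sigma$ with mean curvature $H$ and extrinsic curvature $K$, and put $II'=II-H\,I$. Let $\varphi:\Sigma\to\mathbb R$ be a smooth function such that $\sinh\varphi/\sqrt{H^2-K}$, which is defined where $H^2-K\neq0$, extends to a smooth function on all of $\Sigma$. Put $$A=\cosh\varphi\,I+\frac{\sinh\varphi}{\sqrt{H^2-K}}\,II',\qquad B=\sqrt{H^2-K}\,\sinh\varphi\,I+\cosh\varphi\,II',$$ where in $A$ the quotient stands for its smooth extension. Then $(A,B)$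 is a fundamental pair with mean curvature $H(A,B)=0$ and extrinsic curvature $K(A,B)=-(H^2-K)$. In addition, the following conditions are equivalent: 1. $(A,B)$ is a Codazzi pair; 2. the Hopf differential of $(A,B)$ is holomorphic for the conformal structure induced by $A$; 3. $dH-\sqrt{H^2-K}\,d\varphi=0$ on $\Sigma$. -/

import Mathlib

open scoped Manifold ContDiff Bundle

set_option linter.unusedSectionVars false

noncomputable section

namespace CodazziPairs

/-- The model plane `ℝ²`. -/
abbrev Plane : Type := EuclideanSpace ℝ (Fin 2)

section

variable (M : Type*) [TopologicalSpace M] [ChartedSpace Plane M]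

/-- A (not necessarily continuous) field of real bilinear forms on the tangent planes of `M`. -/
abbrev BilinField : Type _ :=
  (x : M) → TangentSpace (𝓡 2) x →L[ℝ] TangentSpace (𝓡 2) x →L[ℝ] ℝ

/-- A (not necessarily continuous) field of endomorphisms of the tangent planes of `M`. -/
abbrev EndoField : Type _ :=
  (x : M) → TangentSpace (𝓡 2) x →L[ℝ] TangentSpace (𝓡 2) x

/-- A (not necessarily continuous) vector field on `M`. -/
abbrev VecField : Type _ := (x : M) → TangentSpace (𝓡 2) x

end

section

variable {M : Type*} [TopologicalSpace M] [ChartedSpace Plane M] [IsManifold (𝓡 2) ∞ M]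

/-- The vector field `X` is smooth. -/
def SmoothVec (X : VecField M) : Prop :=
  ContMDiff (𝓡 2) (𝓡 2).tangent ∞ (fun x => (⟨x, X x⟩ : TangentBundle (𝓡 2) M))

/-- The vector field `X` is differentiable at `x`. -/
def DiffVecAt (X : VecField M) (x : M) : Prop :=
  MDifferentiableAt (𝓡 2) (𝓡 2).tangent (fun x => (⟨x, X x⟩ : TangentBundle (𝓡 2) M)) x

/-- The field of bilinear forms `B` is smooth. -/
def SmoothBilin (B : BilinField M) : Prop :=
  ContMDiff (𝓡 2) ((𝓡 2).prod 𝓘(ℝ, Plane →L[ℝ] Plane →L[ℝ] ℝ)) ∞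
    (fun x => Bundle.TotalSpace.mk' (Plane →L[ℝ] Plane →L[ℝ] ℝ)
      (E := fun x : M => TangentSpace (𝓡 2) x →L[ℝ] TangentSpace (𝓡 2) x →L[ℝ] ℝ) x (B x))

/-- A fundamental pair: `A` is a smooth Riemannian metric and `B` is a smooth real quadratic form
(given by its symmetric polar form). -/
structure IsFundamentalPair (A B : BilinField M) : Prop where
  metric : ∃ g : Bundle.ContMDiffRiemannianMetric (𝓡 2) ∞ Plane
      (fun x : M => TangentSpace (𝓡 2) x), g.inner = A
  symm : ∀ x v w, B x v w = B x w v
  smooth : SmoothBilin B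

/-- The endomorphism field `S` with `A (S v, w) = B (v, w)`. For a fundamental pair `(A, B)` this
is its shape operator. -/
def shape (A B : BilinField M) : EndoField M := fun x => (A x).inverse ∘L B x

/-- The mean curvature, half the trace of the shape operator. -/
def meanCurv (A B : BilinField M) (x : M) : ℝ :=
  LinearMap.trace ℝ (TangentSpace (𝓡 2) x) (shape A B x : _ →ₗ[ℝ] _) / 2

/-- The extrinsic curvature, the determinant of the shape operator. -/
def extCurv (A B : BilinField M) (x : M) : ℝ :=
  LinearMap.det (shape A B x : TangentSpace (𝓡 2) x →ₗ[ℝ] TangentSpace (𝓡 2) x)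

/-- `cov` is the Levi-Civita connection of `A`: it is torsion free and metric. Here `cov Y x v` is
the derivative at `x` of `Y` in the direction `v`. -/
structure IsLeviCivita (A : BilinField M)
    (cov : CovariantDerivative (𝓡 2) Plane (fun x : M => TangentSpace (𝓡 2) x)) : Prop where
  torsion_eq_zero : cov.torsion = 0
  metric : ∀ (Y Z : VecField M) (x : M) (v : TangentSpace (𝓡 2) x),
    DiffVecAt Y x → DiffVecAt Z x →
    mvfderiv (𝓡 2) (fun y => A y (Y y) (Z y)) x v = A x (cov Y x v) (Z x) + A x (Y x) (cov Z x v)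

/-- A Codazzi pair: a fundamental pair with `∇_X SY - ∇_Y SX - S[X,Y] = 0` for all smooth vector
fields `X, Y`, with `S` the shape operator and `∇` the Levi-Civita connection of `A`. -/
def IsCodazziPair (A B : BilinField M) : Prop :=
  IsFundamentalPair A B ∧
  ∃ cov : CovariantDerivative (𝓡 2) Plane (fun x : M => TangentSpace (𝓡 2) x),
    IsLeviCivita A cov ∧
    ∀ X Y : VecField M, SmoothVec X → SmoothVec Y → ∀ x : M,
      cov (fun y => shape A B y (Y y)) x (X x) - cov (fun y => shape A B y (X y)) x (Y x)
        - shape A B x (VectorField.mlieBracket (𝓡 2) X Y x) = 0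

/-- The square root of `H² - K`. -/
def skewCurv (A B : BilinField M) (x : M) : ℝ := √(meanCurv A B x ^ 2 - extCurv A B x)

/-- An orientation of the surface, represented by a smooth nowhere vanishing 2-form: a pair of
tangent vectors `(v, w)` is positively oriented if `form x v w > 0`. -/
structure SurfaceOrientation (M : Type*) [TopologicalSpace M] [ChartedSpace Plane M]
    [IsManifold (𝓡 2) ∞ M] where
  form : BilinField M
  alternating : ∀ x v, form x v v = 0
  ne_zero : ∀ x, form x ≠ 0
  smooth : SmoothBilin form

/-- The complex structure `J` of the oriented Riemannian surface `(M, A)`, that is, the rotation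
by `+90` degrees, which determines the Riemann surface structure induced by `A`. It is the
positive multiple of determinant `1` of the endomorphism `R` with `A (R v, w) = form (v, w)`. -/
def complexStructure (o : SurfaceOrientation M) (A : BilinField M) : EndoField M :=
  fun x => (√(extCurv A o.form x))⁻¹ • shape A o.form x

/-- A field of complex valued, real bilinear forms on the tangent planes. -/
abbrev ComplexBilinField (M : Type*) [TopologicalSpace M] [ChartedSpace Plane M] : Type _ :=
  (x : M) → TangentSpace (𝓡 2) x → TangentSpace (𝓡 2) x → ℂ

/-- The `(2,0)` part of `B` for the complex structure `J`: the complex bilinear extension of `B`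
evaluated on the `(1,0)` parts `(v - i J v) / 2` and `(w - i J w) / 2` of `v` and `w`. -/
def twoZeroPart (J : EndoField M) (B : BilinField M) : ComplexBilinField M := fun x v w =>
  (((B x v w - B x (J x v) (J x w) : ℝ) : ℂ)
    - Complex.I * ((B x (J x v) w + B x v (J x w) : ℝ) : ℂ)) / 4

/-- The Hopf differential of the pair `(A, B)`: the `(2,0)` part of `B` for the metric `A`. In a
positively oriented local conformal parameter `z = x + iy` for `A` it is `Q dz²`, with
`Q = (B (∂x, ∂x) - B (∂y, ∂y) - 2 i B (∂x, ∂y)) / 4`. -/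
def hopfDifferential (o : SurfaceOrientation M) (A B : BilinField M) : ComplexBilinField M :=
  twoZeroPart (complexStructure o A) B

/-- The Lie derivative `(L_X q)(Y, Z)`. -/
def lieDeriv (q : ComplexBilinField M) (X Y Z : VecField M) (x : M) : ℂ :=
  mvfderiv (𝓡 2) (fun y => q y (Y y) (Z y)) x (X x)
    - q x (VectorField.mlieBracket (𝓡 2) X Y x) (Z x)
    - q x (Y x) (VectorField.mlieBracket (𝓡 2) X Z x)

/-- The Dolbeault operator on quadratic differentials `q` of type `(2,0)`:
`(∂̄_X q)(Y, Z)`, the Lie derivative of `q` along the `(0,1)` part `(X + i J X) / 2` of `X`.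
(This is tensorial in `X, Y, Z`; it is the operator induced by the standard holomorphic structure
`∂̄_X Y = ([X, Y] + J [J X, Y]) / 2` of the tangent bundle.) -/
def dbar (J : EndoField M) (q : ComplexBilinField M) (X Y Z : VecField M) (x : M) : ℂ :=
  (lieDeriv q X Y Z x + Complex.I * lieDeriv q (fun y => J y (X y)) Y Z x) / 2

/-- The quadratic differential `q` of type `(2,0)` is holomorphic for the complex structure `J`.
In a local conformal parameter `z`, for which `q = Q dz²`, this says that `Q_z̄ = 0`. -/
def IsHolomorphicQuadratic (J : EndoField M) (q : ComplexBilinField M) : Prop :=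
  ∀ X Y Z : VecField M, SmoothVec X → SmoothVec Y → SmoothVec Z → ∀ x : M, dbar J q X Y Z x = 0

/-- The first form `cosh φ I + ψ II'` of the new pair, where `II' = II - H I` and `ψ` is the
smooth extension of `sinh φ / √(H² - K)`. -/
def newFirst (g h : BilinField M) (φ ψ : M → ℝ) : BilinField M := fun x =>
  Real.cosh (φ x) • g x + ψ x • (h x - meanCurv g h x • g x)

/-- The second form `√(H² - K) sinh φ I + cosh φ II'` of the new pair. -/
def newSecond (g h : BilinField M) (φ : M → ℝ) : BilinField M := fun x =>
  (skewCurv g h x * Real.sinh (φ x)) • g x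
    + Real.cosh (φ x) • (h x - meanCurv g h x • g x)

/-! Checks of the definitions. -/

/-- On an oriented Euclidean plane, the endomorphism `R` with `A (R v, w) = C (v, w)`, `C` a
nonzero alternating form, satisfies `det R > 0` and `R² = -det R`. -/
theorem rotation_aux {A C : Plane →L[ℝ] Plane →L[ℝ] ℝ} {R : Plane →L[ℝ] Plane}
    (hs : ∀ v w, A v w = A w v) (hp : ∀ v, v ≠ 0 → 0 < A v v) (hC : ∀ v, C v v = 0)
    (h0 : C ≠ 0) (hR : ∀ v w, A (R v) w = C v w) :
    0 < LinearMap.det (R : Plane →ₗ[ℝ] Plane) ∧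
      ∀ v, R (R v) = -(LinearMap.det (R : Plane →ₗ[ℝ] Plane) • v) := by
  have hC' : ∀ v w, C v w = -C w v := fun v w => by
    have h := hC (v + w)
    simp only [map_add, add_apply, hC] at h
    linarith
  have hfr : Module.finrank ℝ Plane = 2 := by simp
  have hspan : ∀ v w : Plane, v ≠ 0 → w ≠ 0 → A v w = 0 → LinearIndependent ℝ ![v, w] := by
    intro v w hv hw hvw
    rw [LinearIndependent.pair_iff]
    intro s t hst
    have h1 := congrArg (A v) hst
    have h2 := congrArg (A w) hst
    simp only [map_add, map_smul, smul_eq_mul, map_zero, hvw, hs w v] at h1 h2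
    exact ⟨by simpa [(hp v hv).ne'] using h1, by simpa [(hp w hw).ne'] using h2⟩
  have hR0 : ∀ v, v ≠ 0 → R v ≠ 0 := by
    intro v hv hv0
    have hCv : ∀ w, C v w = 0 := fun w => by rw [← hR, hv0]; simp
    obtain ⟨w, hw, hvw⟩ : ∃ w, w ≠ 0 ∧ A v w = 0 := by
      by_contra! hne
      have hk : LinearMap.ker (A v : Plane →ₗ[ℝ] ℝ) = ⊥ := by
        rw [LinearMap.ker_eq_bot']
        intro m hm
        by_contra hm0
        exact hne m hm0 hm
      have := LinearMap.finrank_le_finrank_of_injective (LinearMap.ker_eq_bot.1 hk)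
      simp at this
    let b := basisOfLinearIndependentOfCardEqFinrank (hspan v w hv hw hvw) (by simp)
    apply h0
    have hb0 : b 0 = v := by simp [b]
    have hb1 : b 1 = w := by simp [b]
    apply ContinuousLinearMap.coe_injective
    apply b.ext
    intro i
    ext u
    have hu : u = b.repr u 0 • v + b.repr u 1 • w := by
      conv_lhs => rw [← b.sum_repr u, Fin.sum_univ_two, hb0, hb1]
    fin_cases i
    · simp [hb0, hCv]
    · simp only [Fin.mk_one, hb1, ContinuousLinearMap.coe_coe]
      rw [hu]
      simp [hC, hC' w v, hCv]
  have key : ∀ v, v ≠ 0 → 0 < LinearMap.det (R : Plane →ₗ[ℝ] Plane) ∧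
      R (R v) = -(LinearMap.det (R : Plane →ₗ[ℝ] Plane) • v) := by
    intro v hv
    have ho : A v (R v) = 0 := by rw [hs, hR, hC]
    have hv1 := hp v hv
    have hv2 := hp (R v) (hR0 v hv)
    let b := basisOfLinearIndependentOfCardEqFinrank (hspan v (R v) hv (hR0 v hv) ho) (by simp)
    have hb0 : b 0 = v := by simp [b]
    have hb1 : b 1 = R v := by simp [b]
    set c : ℝ := A (R v) (R v) / A v v with hc
    have hcc : c * A v v = A (R v) (R v) := by rw [hc]; field_simp
    have hRR : R (R v) = -(c • v) := by
      by_contra hne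
      have hu0 : R (R v) + c • v ≠ 0 := fun h => hne (eq_neg_of_add_eq_zero_left h)
      have hpos := hp _ hu0
      have e1 : A (R (R v) + c • v) v = 0 := by
        simp only [map_add, map_smul, add_apply, smul_apply,
          smul_eq_mul, hR (R v) v, hC' (R v) v, ← hR v (R v), hcc]
        ring
      have e2 : A (R (R v) + c • v) (R v) = 0 := by
        simp [hR (R v), hC, ho]
      have hu : R (R v) + c • v = b.repr (R (R v) + c • v) 0 • v
          + b.repr (R (R v) + c • v) 1 • R v := by
        conv_lhs => rw [← b.sum_repr (R (R v) + c • v), Fin.sum_univ_two, hb0, hb1]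
      rw [hu, map_add, map_smul, map_smul, ← hu, e1, e2] at hpos
      simp at hpos
    have hdet : LinearMap.det (R : Plane →ₗ[ℝ] Plane) = c := by
      have hm : LinearMap.toMatrix b b (R : Plane →ₗ[ℝ] Plane) = !![0, -c; 1, 0] := by
        have r0 : b.repr v = Finsupp.single 0 1 := by rw [← hb0]; simp
        have r1 : b.repr (R v) = Finsupp.single 1 1 := by rw [← hb1]; simp
        ext i j
        fin_cases i <;> fin_cases j <;>
          simp [LinearMap.toMatrix_apply, hb0, hb1, hRR, r0, r1]
      rw [← LinearMap.det_toMatrix b, hm]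
      simp [Matrix.det_fin_two]
    rw [hdet]
    exact ⟨div_pos hv2 hv1, hRR⟩
  obtain ⟨v0, hv0⟩ := exists_ne (0 : Plane)
  refine ⟨(key v0 hv0).1, fun v => ?_⟩
  by_cases hv : v = 0
  · simp [hv]
  · exact (key v hv).2

/-- The shape operator satisfies its defining equation. -/
theorem IsFundamentalPair.apply_shape {A B : BilinField M} (hAB : IsFundamentalPair A B)
    (C : BilinField M) (x : M) (v w : TangentSpace (𝓡 2) x) :
    A x (shape A C x v) w = C x v w := by
  obtain ⟨g, hg⟩ := hAB.metric
  have hinj : Function.Injective (A x) := by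
    rw [injective_iff_map_eq_zero]
    intro u hu
    by_contra hu0
    have h := g.pos x u hu0
    rw [hg, hu] at h
    simp at h
  have key : ∀ a : Plane →L[ℝ] Plane →L[ℝ] ℝ, Function.Injective a →
      ∀ f : Plane →L[ℝ] ℝ, a (a.inverse f) = f := by
    intro a ha f
    have hfr : Module.finrank ℝ Plane = Module.finrank ℝ (Plane →L[ℝ] ℝ) := by
      rw [(LinearMap.toContinuousLinearMap (𝕜 := ℝ) (E := Plane) (F' := ℝ)).symm.finrank_eq]
      exact (Subspace.dual_finrank_eq (K := ℝ) (V := Plane)).symm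
    let e : Plane ≃L[ℝ] (Plane →L[ℝ] ℝ) :=
      (LinearEquiv.ofInjectiveOfFinrankEq (a : Plane →ₗ[ℝ] (Plane →L[ℝ] ℝ)) ha hfr
        ).toContinuousLinearEquiv
    have he : a = (e : Plane →L[ℝ] (Plane →L[ℝ] ℝ)) := by
      ext u; rfl
    rw [he, ContinuousLinearMap.inverse_equiv]
    simp
  exact congrArg (fun f : Plane →L[ℝ] ℝ => f w) (key (A x) hinj (C x v))

/-- `J` is the rotation by `+90` degrees. -/
theorem IsFundamentalPair.complexStructure_rotation (o : SurfaceOrientation M) {A B : BilinField M}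
    (hAB : IsFundamentalPair A B) (x : M) (v : TangentSpace (𝓡 2) x) :
    complexStructure o A x (complexStructure o A x v) = -v ∧
    A x v (complexStructure o A x v) = 0 ∧
    (v ≠ 0 → 0 < o.form x v (complexStructure o A x v)) := by
  have hR := hAB.apply_shape o.form x
  obtain ⟨g, hg⟩ := hAB.metric
  have hs : ∀ v w, A x v w = A x w v := fun v w => by rw [← hg]; exact g.symm x v w
  have hp : ∀ v, v ≠ 0 → 0 < A x v v := fun v hv => by rw [← hg]; exact g.pos x v hv
  obtain ⟨hd, hsq⟩ := rotation_aux (A := A x) (C := o.form x) (R := shape A o.form x)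
    hs hp (o.alternating x) (o.ne_zero x) hR
  change 0 < extCurv A o.form x at hd
  have hsq' : ∀ v, shape A o.form x (shape A o.form x v) = -(extCurv A o.form x • v) := hsq
  have hrt := Real.sqrt_pos.2 hd
  refine ⟨?_, ?_, fun hv => ?_⟩
  · simp only [complexStructure, smul_apply, map_smul, hsq', smul_neg,
      smul_smul, neg_inj]
    rw [← mul_assoc, ← mul_inv, Real.mul_self_sqrt hd.le, inv_mul_cancel₀ hd.ne', one_smul]
  · simp [complexStructure, hs v, hR, o.alternating]
  · have hne : shape A o.form x v ≠ 0 := by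
      intro h
      have := hsq' v
      rw [h, map_zero, eq_comm, neg_eq_zero, smul_eq_zero] at this
      exact this.elim hd.ne' hv
    have := hp _ hne
    simp only [complexStructure, smul_apply, map_smul, smul_eq_mul, ← hR]
    positivity

/-- In a conformal parameter, with coordinate fields `X = ∂x` and `J X = ∂y` which commute, the
operator `∂̄` is the Cauchy-Riemann operator applied to the coefficient `Q = q (X, X)`. -/
theorem dbar_eq_of_mlieBracket_eq_zero (J : EndoField M) (B : BilinField M) (X : VecField M)
    (x : M) (hX : VectorField.mlieBracket (𝓡 2) X (fun y => J y (X y)) x = 0) :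
    dbar J (twoZeroPart J B) X X X x =
      (mvfderiv (𝓡 2) (fun y => twoZeroPart J B y (X y) (X y)) x (X x)
        + Complex.I * mvfderiv (𝓡 2) (fun y => twoZeroPart J B y (X y) (X y)) x (J x (X x))) / 2
    := by
  have h1 : VectorField.mlieBracket (𝓡 2) (fun y => J y (X y)) X x = 0 := by
    rw [VectorField.mlieBracket_swap_apply, hX, neg_zero]
  simp [dbar, lieDeriv, h1, twoZeroPart]

end

end CodazziPairs

end

/-!
Write `S` for the shape operator of `(g, h)`, `S' = S - H` for its traceless part and
`q = √(H² - K)`, so that `S'² = q²`. With `P = cosh φ + ψ S'` the new forms are `A = g (P ·, ·)` and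
`B = g (P S' ·, ·)`, because `q sinh φ = q² ψ` everywhere. Hence the shape operator of `(A, B)` is
`S'` (`shape_newPair`), which gives the two curvatures; `P` is positive because its eigenvalues are
at least `e^{-|φ|}` (`exp_mul_le_newFirst`).

All three conditions are pointwise, and are compared through the tensor `N w v = (∇'_v S') w`, where
`∇'` is the Levi-Civita connection of `A`. It exists because any torsion free connection, such as
the Levi-Civita connection `∇` of `g`, can be corrected by the Koszul formula
(`exists_isLeviCivita`). The Codazzi equation of `(A, B)` is the symmetry `N w v = N v w`
(`codazzi_iff`).

* Codazzi and `dH = q dφ`. Let `D = ∇' - ∇`. The Codazzi equation of `(g, h)` expresses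
  `N w v - N v w` through `D` and `dH` (`skew_endoDeriv_tracelessShape`). At an umbilic `S' = 0`, and
  only the terms in `dH` remain. Elsewhere, a field `W` of eigenvectors of `S'` for the eigenvalue
  `± q` satisfies `A (W, W) = e^{± φ} g (W, W)`; differentiating this with both connections
  determines `D (w₁, w₂)` for principal directions `w₁, w₂`, and the skew part of `N` becomes
  `θ (w₂) w₁ - θ (w₁) w₂` with `θ = dH - q dφ` (`symm_endoDeriv_newPair_iff`).
* Codazzi and holomorphy. As `J` is parallel for `∇'` and anticommutes with `S'`, four times the
  Dolbeault derivative of the Hopf differential at `X, Y, Z` is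
  `A (N Y X + N (J Y) (J X), Z) + i A (N Y (J X) - N (J Y) X, Z)` (`dbar_hopfDifferential`). Since
  `N (J w) v = - J (N w v)`, this vanishes if and only if `N` is symmetric.
-/

namespace CodazziPairs

/-! ### Linear algebra of symmetric operators on a Euclidean plane -/

section LinearAlgebra

variable {V : Type*} [AddCommGroup V] [Module ℝ V] [TopologicalSpace V]

theorem linearIndependent_of_orthogonal {a : V →L[ℝ] V →L[ℝ] ℝ} (hs : ∀ v w, a v w = a w v)
    (hp : ∀ v, v ≠ 0 → 0 < a v v) {v w : V} (hv : v ≠ 0) (hw : w ≠ 0) (hvw : a v w = 0) :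
    LinearIndependent ℝ ![v, w] := by
  rw [LinearIndependent.pair_iff]
  intro s t hst
  have h1 := congrArg (a v) hst
  have h2 := congrArg (a w) hst
  simp only [map_add, map_smul, smul_eq_mul, map_zero, hvw, hs w v] at h1 h2
  exact ⟨by simpa [(hp v hv).ne'] using h1, by simpa [(hp w hw).ne'] using h2⟩

theorem exists_eq_smul_add_smul (hV : Module.finrank ℝ V = 2) {v w : V}
    (h : LinearIndependent ℝ ![v, w]) (u : V) : ∃ s t : ℝ, u = s • v + t • w := by
  let b := basisOfLinearIndependentOfCardEqFinrank h (by simp [hV])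
  refine ⟨b.repr u 0, b.repr u 1, ?_⟩
  conv_lhs => rw [← b.sum_repr u, Fin.sum_univ_two]
  simp [b]

theorem trace_det_of_pair (hV : Module.finrank ℝ V = 2) {v w : V}
    (h : LinearIndependent ℝ ![v, w]) (S : V →ₗ[ℝ] V) {α β γ δ : ℝ}
    (hv : S v = α • v + β • w) (hw : S w = γ • v + δ • w) :
    LinearMap.trace ℝ V S = α + δ ∧ LinearMap.det S = α * δ - β * γ := by
  let b := basisOfLinearIndependentOfCardEqFinrank h (by simp [hV])
  have hb0 : b 0 = v := by simp [b]
  have hb1 : b 1 = w := by simp [b]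
  have hm : LinearMap.toMatrix b b S = !![α, γ; β, δ] := by
    have r0 : b.repr v = Finsupp.single 0 1 := by rw [← hb0]; simp
    have r1 : b.repr w = Finsupp.single 1 1 := by rw [← hb1]; simp
    ext i j
    fin_cases i <;> fin_cases j <;>
      simp [LinearMap.toMatrix_apply, hb0, hb1, hv, hw, r0, r1]
  constructor
  · rw [LinearMap.trace_eq_matrix_trace ℝ b, hm]
    simp [Matrix.trace_fin_two]
  · rw [← LinearMap.det_toMatrix b, hm]
    simp [Matrix.det_fin_two, mul_comm β]

theorem linearIndependent_pair_of_basis (b : Module.Basis (Fin 2) ℝ V) :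
    LinearIndependent ℝ ![b 0, b 1] := by
  convert b.linearIndependent using 1
  ext i
  fin_cases i <;> rfl

theorem exists_linearIndependent_pair (hV : Module.finrank ℝ V = 2) :
    ∃ v w : V, LinearIndependent ℝ ![v, w] := by
  have : Module.Finite ℝ V := Module.finite_of_finrank_pos (by omega)
  let b := Module.finBasisOfFinrankEq ℝ V hV
  exact ⟨b 0, b 1, linearIndependent_pair_of_basis b⟩

/-- Cayley-Hamilton in dimension two, and the effect of subtracting a scalar on trace and
determinant. -/
theorem trace_det_sub_smul (hV : Module.finrank ℝ V = 2) (S : V →ₗ[ℝ] V) (c : ℝ) :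
    LinearMap.trace ℝ V (S - c • LinearMap.id) = LinearMap.trace ℝ V S - 2 * c ∧
    LinearMap.det (S - c • LinearMap.id)
      = LinearMap.det S - c * LinearMap.trace ℝ V S + c ^ 2 ∧
    ∀ v, S (S v) = LinearMap.trace ℝ V S • S v - LinearMap.det S • v := by
  obtain ⟨v, w, h⟩ := exists_linearIndependent_pair hV
  obtain ⟨α, β, hv⟩ := exists_eq_smul_add_smul hV h (S v)
  obtain ⟨γ, δ, hw⟩ := exists_eq_smul_add_smul hV h (S w)
  obtain ⟨ht, hd⟩ := trace_det_of_pair hV h S hv hw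
  obtain ⟨ht', hd'⟩ := trace_det_of_pair hV h (S - c • LinearMap.id) (α := α - c) (β := β)
    (γ := γ) (δ := δ - c) (by simp [hv]; module) (by simp [hw]; module)
  refine ⟨by rw [ht', ht]; ring, by rw [hd', hd, ht]; ring, fun u => ?_⟩
  obtain ⟨s, t, rfl⟩ := exists_eq_smul_add_smul hV h u
  simp only [ht, hd, map_add, map_smul, hv, hw]
  module

/-- The Gram determinant of two independent vectors is positive. -/
theorem gram_pos {a : V →L[ℝ] V →L[ℝ] ℝ} (hs : ∀ v w, a v w = a w v)
    (hp : ∀ v, v ≠ 0 → 0 < a v v) {v w : V} (h : LinearIndependent ℝ ![v, w]) :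
    0 < a v v * a w w - a v w ^ 2 := by
  have hv : v ≠ 0 := h.ne_zero 0
  have hu : -a v w • v + a v v • w ≠ 0 := fun h0 =>
    (hp v hv).ne' ((LinearIndependent.pair_iff.1 h _ _ h0).2)
  have h1 := hp _ hu
  simp only [map_add, map_smul, add_apply, smul_apply, smul_eq_mul, hs w v] at h1
  have h2 := hp v hv
  have : 0 < a v v * (a v v * a w w - a v w ^ 2) := by linarith
  exact (pos_iff_pos_of_mul_pos this).1 h2

/-- Trace and determinant of the operator `S` with `a (S v, w) = b (v, w)`, in terms of the
matrices of `a` and `b` in a basis. -/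
theorem trace_det_of_gram (hV : Module.finrank ℝ V = 2) {a b : V →L[ℝ] V →L[ℝ] ℝ}
    (hs : ∀ v w, a v w = a w v) (hp : ∀ v, v ≠ 0 → 0 < a v v) {S : V →L[ℝ] V}
    (hS : ∀ v w, a (S v) w = b v w) {v w : V} (h : LinearIndependent ℝ ![v, w]) :
    LinearMap.trace ℝ V (S : V →ₗ[ℝ] V) =
      (a w w * b v v - a v w * (b v w + b w v) + a v v * b w w)
        / (a v v * a w w - a v w ^ 2) ∧
    LinearMap.det (S : V →ₗ[ℝ] V) =
      (b v v * b w w - b v w * b w v) / (a v v * a w w - a v w ^ 2) := by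
  obtain ⟨α, β, hv⟩ := exists_eq_smul_add_smul hV h (S v)
  obtain ⟨γ, δ, hw⟩ := exists_eq_smul_add_smul hV h (S w)
  obtain ⟨ht, hd⟩ := trace_det_of_pair hV h (S : V →ₗ[ℝ] V) hv hw
  have hg := (gram_pos hs hp h).ne'
  simp only [← hS, hv, hw, ht, hd, map_add, map_smul, add_apply, smul_apply, smul_eq_mul, hs w v]
  constructor <;> rw [eq_div_iff hg] <;> ring

section Traceless

variable (hV : Module.finrank ℝ V = 2) {a : V →L[ℝ] V →L[ℝ] ℝ} (hs : ∀ v w, a v w = a w v)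
  (hp : ∀ v, v ≠ 0 → 0 < a v v) {T : V →L[ℝ] V} (hT : ∀ v w, a (T v) w = a v (T w))
  (htr : LinearMap.trace ℝ V (T : V →ₗ[ℝ] V) = 0)

include hV htr in
theorem apply_apply_of_trace_eq_zero (v : V) :
    T (T v) = (-LinearMap.det (T : V →ₗ[ℝ] V)) • v := by
  have := (trace_det_sub_smul hV (T : V →ₗ[ℝ] V) 0).2.2 v
  rw [htr] at this
  simpa using this

include hV hp hT htr in
theorem neg_det_nonneg : 0 ≤ -LinearMap.det (T : V →ₗ[ℝ] V) := by
  obtain ⟨v, w, h⟩ := exists_linearIndependent_pair hV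
  have hv : v ≠ 0 := h.ne_zero 0
  have h1 : 0 ≤ a (T v) (T v) := by
    by_cases h0 : T v = 0
    · simp [h0]
    · exact (hp _ h0).le
  rw [hT, apply_apply_of_trace_eq_zero hV htr, map_smul, smul_eq_mul] at h1
  exact nonneg_of_mul_nonneg_left h1 (hp v hv)

include hV hp hT htr in
theorem eq_zero_of_det_eq_zero (h0 : LinearMap.det (T : V →ₗ[ℝ] V) = 0) (v : V) : T v = 0 := by
  by_contra hv
  have h1 := hp _ hv
  rw [hT, apply_apply_of_trace_eq_zero hV htr, h0] at h1
  simp at h1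

include hV hs hp hT htr in
/-- The eigenvalues of `T` are `± √(-det T)`. -/
theorem abs_apply_le (v : V) :
    |a (T v) v| ≤ √(-LinearMap.det (T : V →ₗ[ℝ] V)) * a v v := by
  set q := √(-LinearMap.det (T : V →ₗ[ℝ] V)) with hq
  have hq2 : q ^ 2 = -LinearMap.det (T : V →ₗ[ℝ] V) :=
    Real.sq_sqrt (neg_det_nonneg hV hp hT htr)
  have hnn : ∀ u, 0 ≤ a u u := fun u => by
    by_cases h0 : u = 0
    · simp [h0]
    · exact (hp _ h0).le
  rcases (Real.sqrt_nonneg (-LinearMap.det (T : V →ₗ[ℝ] V))).eq_or_lt' with h0 | h0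
  · have hd : LinearMap.det (T : V →ₗ[ℝ] V) = 0 := by
      rw [← hq] at h0
      rw [h0] at hq2
      linarith
    rw [eq_zero_of_det_eq_zero hV hp hT htr hd]
    simp [hq, h0]
  · have key : ∀ c : ℝ, c ^ 2 = q ^ 2 → 0 ≤ 2 * (q ^ 2 * a v v + c * a (T v) v) := fun c hc => by
      have h1 := hnn (T v + c • v)
      simp only [map_add, map_smul, add_apply, smul_apply, smul_eq_mul] at h1
      rw [hT v (T v), apply_apply_of_trace_eq_zero hV htr, map_smul, smul_eq_mul, ← hq2,
        hs v (T v)] at h1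
      have hc' : c * (c * a v v) = q ^ 2 * a v v := by rw [← hc]; ring
      linarith
    rw [← hq] at h0
    have h1 := key q rfl
    have h2 := key (-q) (by ring)
    have e1 : 0 ≤ q * (q * a v v + a (T v) v) := by linarith
    have e2 : 0 ≤ q * (q * a v v - a (T v) v) := by linarith
    have e1' := nonneg_of_mul_nonneg_right e1 h0
    have e2' := nonneg_of_mul_nonneg_right e2 h0
    rw [abs_le]
    constructor <;> linarith

include hV hs hp hT htr in
/-- A traceless symmetric operator of a Euclidean plane anticommutes with the rotation `J`. -/
theorem apply_rotation {J : V →L[ℝ] V} (hJ : ∀ v, J (J v) = -v) (hJo : ∀ v, a v (J v) = 0)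
    (v : V) : T (J v) = -J (T v) := by
  by_cases hv : v = 0
  · simp [hv]
  have hJv : J v ≠ 0 := fun h => by
    have := hJ v
    rw [h, map_zero, eq_comm, neg_eq_zero] at this
    exact hv this
  have hi := linearIndependent_of_orthogonal hs hp hv hJv (hJo v)
  have hnorm : a (J v) (J v) = a v v := by
    have h1 := hJo (v + J v)
    simp only [map_add, add_apply, hJ, hJo, map_neg, hs (J v) v] at h1
    linarith
  obtain ⟨α, β, h1⟩ := exists_eq_smul_add_smul hV hi (T v)
  obtain ⟨γ, δ, h2⟩ := exists_eq_smul_add_smul hV hi (T (J v))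
  have ht := (trace_det_of_pair hV hi (T : V →ₗ[ℝ] V) h1 h2).1
  rw [htr] at ht
  have hsym := hT v (J v)
  rw [h1, h2] at hsym
  simp only [map_add, map_smul, add_apply, smul_apply, smul_eq_mul, hJo, hnorm] at hsym
  have hβ : β = γ := mul_right_cancel₀ (hp v hv).ne' (by linarith)
  have hδ : δ = -α := by linarith
  rw [h1, h2, hδ, ← hβ, map_add, map_smul, map_smul, hJ]
  module

include hV htr in
/-- A traceless operator differs from every nonzero scalar. -/
theorem exists_apply_add_smul_ne_zero {q : ℝ} (hq : q ≠ 0) : ∃ v, T v + q • v ≠ 0 := by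
  by_contra! h
  obtain ⟨v, w, hi⟩ := exists_linearIndependent_pair hV
  have := (trace_det_of_pair hV hi (T : V →ₗ[ℝ] V) (α := -q) (β := 0) (γ := 0) (δ := -q)
    (by simp [eq_neg_of_add_eq_zero_left (h v)]) (by simp [eq_neg_of_add_eq_zero_left (h w)])).1
  rw [htr] at this
  exact hq (by linarith)

end Traceless

end LinearAlgebra

/-! ### Differentiability of fields on a surface -/

section Fields

open Bundle Topology

variable {M : Type*} [TopologicalSpace M] [ChartedSpace Plane M] [IsManifold (𝓡 2) ∞ M]

theorem finrank_tangentSpace (x : M) : Module.finrank ℝ (TangentSpace (𝓡 2) x) = 2 :=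
  finrank_euclideanSpace_fin

theorem IsFundamentalPair.metric_symm {A B : BilinField M} (h : IsFundamentalPair A B) (x : M)
    (v w : TangentSpace (𝓡 2) x) : A x v w = A x w v := by
  obtain ⟨g, rfl⟩ := h.metric
  exact g.symm x v w

theorem IsFundamentalPair.metric_pos {A B : BilinField M} (h : IsFundamentalPair A B) (x : M)
    (v : TangentSpace (𝓡 2) x) (hv : v ≠ 0) : 0 < A x v v := by
  obtain ⟨g, rfl⟩ := h.metric
  exact g.pos x v hv

theorem IsFundamentalPair.metric_smooth {A B : BilinField M} (h : IsFundamentalPair A B) :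
    SmoothBilin A := by
  obtain ⟨g, rfl⟩ := h.metric
  exact g.contMDiff

theorem IsFundamentalPair.metric_nondegenerate {A B : BilinField M} (h : IsFundamentalPair A B)
    {x : M} {v w : TangentSpace (𝓡 2) x} (hvw : ∀ u, A x v u = A x w u) : v = w := by
  by_contra hne
  have := h.metric_pos x (v - w) (sub_ne_zero.2 hne)
  rw [map_sub (A x), sub_apply, hvw, sub_self] at this
  exact this.ne rfl

theorem SmoothBilin.contMDiffAt {B : BilinField M} (hB : SmoothBilin B) {X Y : VecField M} {x : M}
    (hX : ContMDiffAt (𝓡 2) (𝓡 2).tangent ∞ (fun y => (⟨y, X y⟩ : TangentBundle (𝓡 2) M)) x)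
    (hY : ContMDiffAt (𝓡 2) (𝓡 2).tangent ∞ (fun y => (⟨y, Y y⟩ : TangentBundle (𝓡 2) M)) x) :
    ContMDiffAt (𝓡 2) 𝓘(ℝ, ℝ) ∞ (fun y => B y (X y) (Y y)) x := by
  have : ContMDiffAt (𝓡 2) ((𝓡 2).prod 𝓘(ℝ)) ∞
      (fun m ↦ TotalSpace.mk' ℝ (E := Bundle.Trivial M ℝ) m (B m (X m) (Y m))) x :=
    ContMDiffAt.clm_bundle_apply₂ (F₁ := Plane) (F₂ := Plane) (hB x) hX hY
  simp only [contMDiffAt_totalSpace] at this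
  exact this.2

theorem SmoothBilin.mdifferentiableAt {B : BilinField M} (hB : SmoothBilin B) {X Y : VecField M}
    {x : M} (hX : DiffVecAt X x) (hY : DiffVecAt Y x) :
    MDifferentiableAt (𝓡 2) 𝓘(ℝ, ℝ) (fun y => B y (X y) (Y y)) x := by
  have : MDifferentiableAt (𝓡 2) ((𝓡 2).prod 𝓘(ℝ))
      (fun m ↦ TotalSpace.mk' ℝ (E := Bundle.Trivial M ℝ) m (B m (X m) (Y m))) x :=
    MDifferentiableAt.clm_bundle_apply₂ (F₁ := Plane) (F₂ := Plane)
      ((hB x).mdifferentiableAt (by simp)) hX hY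
  simp only [mdifferentiableAt_totalSpace] at this
  exact this.2

theorem SmoothVec.diffVecAt {X : VecField M} (hX : SmoothVec X) (x : M) : DiffVecAt X x :=
  (hX x).mdifferentiableAt (by simp)

theorem DiffVecAt.add {X Y : VecField M} {x : M} (hX : DiffVecAt X x) (hY : DiffVecAt Y x) :
    DiffVecAt (fun y => X y + Y y) x :=
  mdifferentiableAt_add_section hX hY

theorem DiffVecAt.sub {X Y : VecField M} {x : M} (hX : DiffVecAt X x) (hY : DiffVecAt Y x) :
    DiffVecAt (fun y => X y - Y y) x :=
  mdifferentiableAt_sub_section hX hY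

theorem DiffVecAt.smul {f : M → ℝ} {X : VecField M} {x : M}
    (hf : MDifferentiableAt (𝓡 2) 𝓘(ℝ, ℝ) f x) (hX : DiffVecAt X x) :
    DiffVecAt (fun y => f y • X y) x :=
  MDifferentiableAt.smul_section hf hX

theorem DiffVecAt.congr {X Y : VecField M} {x : M} (hX : DiffVecAt X x)
    (h : ∀ᶠ y in 𝓝 x, Y y = X y) : DiffVecAt Y x :=
  MDifferentiableAt.congr_of_eventuallyEq hX (h.mono fun y hy => by simp [hy])

theorem diffVecAt_extend {x : M} (v : TangentSpace (𝓡 2) x) :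
    DiffVecAt (FiberBundle.extend Plane v) x :=
  FiberBundle.mdifferentiableAt_extend (𝓡 2) Plane v

/-- Near every point there is a smooth frame of the tangent bundle. -/
theorem exists_local_frame (x : M) : ∃ X Y : VecField M,
    ContMDiffAt (𝓡 2) (𝓡 2).tangent ∞ (fun y => (⟨y, X y⟩ : TangentBundle (𝓡 2) M)) x ∧
    ContMDiffAt (𝓡 2) (𝓡 2).tangent ∞ (fun y => (⟨y, Y y⟩ : TangentBundle (𝓡 2) M)) x ∧
    ∀ᶠ y in 𝓝 x, LinearIndependent ℝ ![X y, Y y] := by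
  let e := trivializationAt Plane (TangentSpace (𝓡 2) : M → Type _) x
  let b := (EuclideanSpace.basisFun (Fin 2) ℝ).toBasis
  have hx : x ∈ e.baseSet := FiberBundle.mem_baseSet_trivializationAt' x
  refine ⟨e.localFrame b 0, e.localFrame b 1, contMDiffAt_localFrame_of_mem ∞ e b 0 hx,
    contMDiffAt_localFrame_of_mem ∞ e b 1 hx, ?_⟩
  filter_upwards [e.open_baseSet.mem_nhds hx] with y hy
  rw [e.localFrame_apply_of_mem_baseSet b hy, e.localFrame_apply_of_mem_baseSet b hy]
  exact linearIndependent_pair_of_basis _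

variable [T2Space M]

theorem exists_smoothVec {x : M} (v : TangentSpace (𝓡 2) x) :
    ∃ X : VecField M, SmoothVec X ∧ X x = v := by
  obtain ⟨s, hs, hX⟩ := FiberBundle.exists_contMDiffOn_extend (k := ∞) (𝓡 2) Plane v
  obtain ⟨u, hus, hu, hxu⟩ := mem_nhds_iff.1 hs
  obtain ⟨f, -, hf⟩ := (SmoothBumpFunction.nhds_basis_tsupport (I := 𝓡 2) x).mem_iff.1
    (hu.mem_nhds hxu)
  refine ⟨(f : M → ℝ) • FiberBundle.extend Plane v, ?_, by simp⟩
  exact ContMDiffOn.smul_section_of_tsupport f.contMDiff.contMDiffOn hu hf (hX.mono hus)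

end Fields

section Riesz

open Bundle Topology

variable {M : Type*} [TopologicalSpace M] [ChartedSpace Plane M] [IsManifold (𝓡 2) ∞ M]
  {A B : BilinField M} (hAB : IsFundamentalPair A B)

include hAB

/-- The inverse of the Gram determinant of a smooth frame is smooth. -/
theorem IsFundamentalPair.contMDiffAt_inv_gram {X Y : VecField M} {x : M}
    (hX : ContMDiffAt (𝓡 2) (𝓡 2).tangent ∞ (fun y => (⟨y, X y⟩ : TangentBundle (𝓡 2) M)) x)
    (hY : ContMDiffAt (𝓡 2) (𝓡 2).tangent ∞ (fun y => (⟨y, Y y⟩ : TangentBundle (𝓡 2) M)) x)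
    (hi : LinearIndependent ℝ ![X x, Y x]) :
    ContMDiffAt (𝓡 2) 𝓘(ℝ, ℝ) ∞
      (fun y => (A y (X y) (X y) * A y (Y y) (Y y) - A y (X y) (Y y) ^ 2)⁻¹) x := by
  have hA := hAB.metric_smooth
  refine ContMDiffAt.inv₀ ?_ (gram_pos (hAB.metric_symm x) (hAB.metric_pos x) hi).ne'
  exact ((hA.contMDiffAt hX hX).mul (hA.contMDiffAt hY hY)).sub ((hA.contMDiffAt hX hY).pow 2)

/-- A vector field is differentiable if its inner products with differentiable fields are. -/
theorem IsFundamentalPair.diffVecAt_of_inner {W : VecField M} {x : M}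
    (hW : ∀ Z : VecField M, DiffVecAt Z x →
      MDifferentiableAt (𝓡 2) 𝓘(ℝ, ℝ) (fun y => A y (W y) (Z y)) x) : DiffVecAt W x := by
  obtain ⟨X, Y, hX, hY, hi⟩ := exists_local_frame x
  have hX' : DiffVecAt X x := hX.mdifferentiableAt (by simp)
  have hY' : DiffVecAt Y x := hY.mdifferentiableAt (by simp)
  have hA := hAB.metric_smooth
  have hg := (hAB.contMDiffAt_inv_gram hX hY hi.self_of_nhds).mdifferentiableAt (by simp)
  -- Cramer's rule for the coefficients of `W` in the frame `X, Y`.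
  refine DiffVecAt.congr (DiffVecAt.add (DiffVecAt.smul (f := fun y =>
      (A y (W y) (X y) * A y (Y y) (Y y) - A y (W y) (Y y) * A y (X y) (Y y)) *
        (A y (X y) (X y) * A y (Y y) (Y y) - A y (X y) (Y y) ^ 2)⁻¹) ?_ hX')
    (DiffVecAt.smul (f := fun y =>
      (A y (W y) (Y y) * A y (X y) (X y) - A y (W y) (X y) * A y (X y) (Y y)) *
        (A y (X y) (X y) * A y (Y y) (Y y) - A y (X y) (Y y) ^ 2)⁻¹) ?_ hY')) ?_
  · exact (((hW X hX').mul (hA.mdifferentiableAt hY' hY')).sub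
      ((hW Y hY').mul (hA.mdifferentiableAt hX' hY'))).mul hg
  · exact (((hW Y hY').mul (hA.mdifferentiableAt hX' hX')).sub
      ((hW X hX').mul (hA.mdifferentiableAt hX' hY'))).mul hg
  · filter_upwards [hi] with y hy
    obtain ⟨s, t, hst⟩ := exists_eq_smul_add_smul (finrank_tangentSpace y) hy (W y)
    have hpos := (gram_pos (hAB.metric_symm y) (hAB.metric_pos y) hy).ne'
    rw [hst]
    simp only [map_add, map_smul, add_apply, smul_apply, smul_eq_mul, hAB.metric_symm y (Y y) (X y)]
    congr 2 <;> rw [← div_eq_mul_inv, eq_div_iff hpos] <;> ring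

theorem IsFundamentalPair.diffVecAt_shape {C : BilinField M} (hC : SmoothBilin C) {X : VecField M}
    {x : M} (hX : DiffVecAt X x) : DiffVecAt (fun y => shape A C y (X y)) x :=
  hAB.diffVecAt_of_inner fun Z hZ => by
    simpa only [hAB.apply_shape] using hC.mdifferentiableAt hX hZ

theorem IsFundamentalPair.contMDiff_meanCurv {C : BilinField M} (hC : SmoothBilin C) :
    ContMDiff (𝓡 2) 𝓘(ℝ, ℝ) ∞ (meanCurv A C) := by
  intro x
  obtain ⟨X, Y, hX, hY, hi⟩ := exists_local_frame x
  have hA := hAB.metric_smooth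
  have h1 := (((hA.contMDiffAt hY hY).mul (hC.contMDiffAt hX hX)).sub
    ((hA.contMDiffAt hX hY).mul ((hC.contMDiffAt hX hY).add (hC.contMDiffAt hY hX)))).add
    ((hA.contMDiffAt hX hX).mul (hC.contMDiffAt hY hY))
  refine ((h1.mul (hAB.contMDiffAt_inv_gram hX hY hi.self_of_nhds)).mul
    (contMDiffAt_const (c := (2 : ℝ)⁻¹))).congr_of_eventuallyEq ?_
  filter_upwards [hi] with y hy
  rw [meanCurv, (trace_det_of_gram (finrank_tangentSpace y) (hAB.metric_symm y)
    (hAB.metric_pos y) (hAB.apply_shape C y) hy).1]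
  rfl

theorem IsFundamentalPair.contMDiff_extCurv {C : BilinField M} (hC : SmoothBilin C) :
    ContMDiff (𝓡 2) 𝓘(ℝ, ℝ) ∞ (extCurv A C) := by
  intro x
  obtain ⟨X, Y, hX, hY, hi⟩ := exists_local_frame x
  have h1 := ((hC.contMDiffAt hX hX).mul (hC.contMDiffAt hY hY)).sub
    ((hC.contMDiffAt hX hY).mul (hC.contMDiffAt hY hX))
  refine (h1.mul (hAB.contMDiffAt_inv_gram hX hY hi.self_of_nhds)).congr_of_eventuallyEq ?_
  filter_upwards [hi] with y hy
  rw [extCurv, (trace_det_of_gram (finrank_tangentSpace y) (hAB.metric_symm y)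
    (hAB.metric_pos y) (hAB.apply_shape C y) hy).2]
  rfl

end Riesz

/-! ### The new pair and its shape operator -/

section NewPair

open Bundle Topology

variable {M : Type*} [TopologicalSpace M] [ChartedSpace Plane M] [IsManifold (𝓡 2) ∞ M]

theorem SmoothBilin.add {B C : BilinField M} (hB : SmoothBilin B) (hC : SmoothBilin C) :
    SmoothBilin (fun x => B x + C x) :=
  ContMDiff.add_section hB hC

theorem SmoothBilin.sub {B C : BilinField M} (hB : SmoothBilin B) (hC : SmoothBilin C) :
    SmoothBilin (fun x => B x - C x) :=
  ContMDiff.sub_section hB hC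

theorem SmoothBilin.smul {f : M → ℝ} {B : BilinField M} (hf : ContMDiff (𝓡 2) 𝓘(ℝ, ℝ) ∞ f)
    (hB : SmoothBilin B) : SmoothBilin (fun x => f x • B x) :=
  ContMDiff.smul_section hf hB

/-- A form bounded below by a positive multiple of a form with bounded unit ball has bounded unit
ball. -/
theorem isVonNBounded_of_le {V : Type*} [AddCommGroup V] [Module ℝ V] [TopologicalSpace V]
    [ContinuousConstSMul ℝ V] {a b : V →L[ℝ] V →L[ℝ] ℝ}
    (ha : Bornology.IsVonNBounded ℝ {v | a v v < 1}) {c : ℝ} (hc : 0 < c)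
    (hab : ∀ v, c ^ 2 * a v v ≤ b v v) : Bornology.IsVonNBounded ℝ {v | b v v < 1} := by
  refine Bornology.IsVonNBounded.subset ?_ (ha.image (c⁻¹ • ContinuousLinearMap.id ℝ V))
  intro v hv
  refine ⟨c • v, ?_, ?_⟩
  · have := hab v
    simp only [Set.mem_ofPred_eq, map_smul, smul_apply, smul_eq_mul] at hv ⊢
    linarith
  · simp [smul_smul, hc.ne']

/-- The traceless part `S - H` of the shape operator, that is, the operator representing
`II' = II - H I`. -/
noncomputable def tracelessShape (g h : BilinField M) : EndoField M := fun x =>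
  shape g h x - meanCurv g h x • ContinuousLinearMap.id ℝ (TangentSpace (𝓡 2) x)

theorem tracelessShape_apply (g h : BilinField M) (x : M) (v : TangentSpace (𝓡 2) x) :
    tracelessShape g h x v = shape g h x v - meanCurv g h x • v := rfl

variable {g h : BilinField M}

theorem trace_det_tracelessShape (g h : BilinField M) (x : M) :
    LinearMap.trace ℝ (TangentSpace (𝓡 2) x)
      (tracelessShape g h x : TangentSpace (𝓡 2) x →ₗ[ℝ] TangentSpace (𝓡 2) x) = 0 ∧
    LinearMap.det (tracelessShape g h x : TangentSpace (𝓡 2) x →ₗ[ℝ] TangentSpace (𝓡 2) x)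
      = -(meanCurv g h x ^ 2 - extCurv g h x) := by
  obtain ⟨h1, h2, -⟩ := trace_det_sub_smul (finrank_tangentSpace x)
    (shape g h x : TangentSpace (𝓡 2) x →ₗ[ℝ] TangentSpace (𝓡 2) x) (meanCurv g h x)
  have ht : LinearMap.trace ℝ (TangentSpace (𝓡 2) x)
      (shape g h x : TangentSpace (𝓡 2) x →ₗ[ℝ] TangentSpace (𝓡 2) x) = 2 * meanCurv g h x := by
    rw [meanCurv]; ring
  rw [ht] at h1 h2
  refine ⟨h1.trans (by ring), h2.trans ?_⟩
  rw [extCurv]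
  ring

variable (hF : IsFundamentalPair g h)

include hF

theorem IsFundamentalPair.apply_tracelessShape (x : M) (v w : TangentSpace (𝓡 2) x) :
    g x (tracelessShape g h x v) w = h x v w - meanCurv g h x * g x v w := by
  simp only [tracelessShape_apply, map_sub, map_smul, sub_apply, smul_apply, smul_eq_mul,
    hF.apply_shape]

theorem IsFundamentalPair.tracelessShape_symm (x : M) (v w : TangentSpace (𝓡 2) x) :
    g x (tracelessShape g h x v) w = g x v (tracelessShape g h x w) := by
  rw [hF.metric_symm x v, hF.apply_tracelessShape, hF.apply_tracelessShape, hF.symm,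
    hF.metric_symm x v]

theorem IsFundamentalPair.skewCurv_sq (x : M) :
    skewCurv g h x ^ 2 = meanCurv g h x ^ 2 - extCurv g h x := by
  have := neg_det_nonneg (finrank_tangentSpace x) (hF.metric_pos x) (hF.tracelessShape_symm x)
    (trace_det_tracelessShape g h x).1
  rw [(trace_det_tracelessShape g h x).2, neg_neg] at this
  exact Real.sq_sqrt this

theorem IsFundamentalPair.tracelessShape_tracelessShape (x : M) (v : TangentSpace (𝓡 2) x) :
    tracelessShape g h x (tracelessShape g h x v) = skewCurv g h x ^ 2 • v := by
  rw [apply_apply_of_trace_eq_zero (finrank_tangentSpace x) (trace_det_tracelessShape g h x).1,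
    (trace_det_tracelessShape g h x).2, neg_neg, hF.skewCurv_sq]

theorem IsFundamentalPair.tracelessShape_eq_zero {x : M} (hx : skewCurv g h x = 0)
    (v : TangentSpace (𝓡 2) x) : tracelessShape g h x v = 0 := by
  refine eq_zero_of_det_eq_zero (finrank_tangentSpace x) (hF.metric_pos x)
    (hF.tracelessShape_symm x) (trace_det_tracelessShape g h x).1 ?_ v
  rw [(trace_det_tracelessShape g h x).2, ← hF.skewCurv_sq, hx]
  ring

theorem IsFundamentalPair.newFirst_apply (φ ψ : M → ℝ) (x : M) (v w : TangentSpace (𝓡 2) x) :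
    newFirst g h φ ψ x v w =
      Real.cosh (φ x) * g x v w + ψ x * g x (tracelessShape g h x v) w := by
  simp [newFirst, hF.apply_tracelessShape]

theorem IsFundamentalPair.newSecond_apply (φ : M → ℝ) (x : M) (v w : TangentSpace (𝓡 2) x) :
    newSecond g h φ x v w = skewCurv g h x * Real.sinh (φ x) * g x v w
      + Real.cosh (φ x) * g x (tracelessShape g h x v) w := by
  simp [newSecond, hF.apply_tracelessShape]

variable {φ ψ : M → ℝ}
  (hext : ∀ x, skewCurv g h x ≠ 0 → ψ x = Real.sinh (φ x) / skewCurv g h x)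

include hext

/-- The factor `e^{-|φ|}` bounds the eigenvalues of the first form with respect to `g` from
below. -/
theorem IsFundamentalPair.exp_mul_le_newFirst (x : M) (v : TangentSpace (𝓡 2) x) :
    Real.exp (-|φ x|) * g x v v ≤ newFirst g h φ ψ x v v := by
  rw [hF.newFirst_apply]
  have hg : 0 ≤ g x v v := by
    by_cases h0 : v = 0
    · simp [h0]
    · exact (hF.metric_pos x v h0).le
  have h1 := abs_apply_le (finrank_tangentSpace x) (hF.metric_symm x) (hF.metric_pos x)
    (hF.tracelessShape_symm x) (trace_det_tracelessShape g h x).1 v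
  rw [(trace_det_tracelessShape g h x).2, neg_neg] at h1
  change _ ≤ skewCurv g h x * _ at h1
  have hq0 : 0 ≤ skewCurv g h x := Real.sqrt_nonneg _
  have h2 : |ψ x| * skewCurv g h x ≤ |Real.sinh (φ x)| := by
    by_cases hq : skewCurv g h x = 0
    · simp [hq]
    · rw [hext x hq, abs_div, abs_of_nonneg hq0, div_mul_cancel₀ _ hq]
  have h3 : |ψ x * g x (tracelessShape g h x v) v| ≤ |Real.sinh (φ x)| * g x v v := by
    rw [abs_mul]
    calc _ ≤ |ψ x| * (skewCurv g h x * g x v v) := by gcongr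
      _ = |ψ x| * skewCurv g h x * g x v v := by ring
      _ ≤ _ := by gcongr
  have h4 : Real.exp (-|φ x|) = Real.cosh (φ x) - |Real.sinh (φ x)| := by
    rw [Real.abs_sinh, ← Real.cosh_abs, Real.cosh_sub_sinh]
  rw [h4]
  have := (abs_le.1 h3).1
  linarith

theorem IsFundamentalPair.newFirst_pos (x : M) (v : TangentSpace (𝓡 2) x) (hv : v ≠ 0) :
    0 < newFirst g h φ ψ x v v :=
  (mul_pos (Real.exp_pos _) (hF.metric_pos x v hv)).trans_le (hF.exp_mul_le_newFirst hext x v)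

/-- The coefficient `√(H² - K) sinh φ` equals `(H² - K) ψ`, also at umbilics, where both vanish. -/
theorem IsFundamentalPair.skewCurv_mul_sinh (x : M) :
    skewCurv g h x * Real.sinh (φ x) = skewCurv g h x ^ 2 * ψ x := by
  by_cases hq : skewCurv g h x = 0
  · simp [hq]
  · rw [hext x hq]
    field_simp

variable (hφ : ContMDiff (𝓡 2) 𝓘(ℝ, ℝ) ∞ φ) (hψ : ContMDiff (𝓡 2) 𝓘(ℝ, ℝ) ∞ ψ)

include hφ hψ

theorem IsFundamentalPair.newPair : IsFundamentalPair (newFirst g h φ ψ) (newSecond g h φ) := by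
  have hH := hF.contMDiff_meanCurv hF.smooth
  have hK := hF.contMDiff_extCurv hF.smooth
  have hcosh : ContMDiff (𝓡 2) 𝓘(ℝ, ℝ) ∞ (fun x => Real.cosh (φ x)) :=
    Real.contDiff_cosh.contMDiff.comp hφ
  have hII : SmoothBilin (fun x => h x - meanCurv g h x • g x) :=
    hF.smooth.sub (hF.metric_smooth.smul hH)
  have hfirst : SmoothBilin (newFirst g h φ ψ) := (hF.metric_smooth.smul hcosh).add (hII.smul hψ)
  have hc : ContMDiff (𝓡 2) 𝓘(ℝ, ℝ) ∞ (fun x => skewCurv g h x * Real.sinh (φ x)) := by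
    simp only [hF.skewCurv_mul_sinh hext, hF.skewCurv_sq]
    exact ((hH.pow 2).sub hK).mul hψ
  have hsecond : SmoothBilin (newSecond g h φ) := (hF.metric_smooth.smul hc).add (hII.smul hcosh)
  have hbdd : ∀ x, Bornology.IsVonNBounded ℝ
      {v : TangentSpace (𝓡 2) x | newFirst g h φ ψ x v v < 1} := fun x => by
    obtain ⟨G, hG⟩ := hF.metric
    have h1 := G.isVonNBounded x
    rw [hG] at h1
    refine isVonNBounded_of_le h1 (Real.exp_pos (-|φ x| / 2)) fun v => ?_
    rw [← Real.exp_nat_mul]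
    convert hF.exp_mul_le_newFirst hext x v using 3
    push_cast
    ring
  have hsymm : ∀ x (v w : TangentSpace (𝓡 2) x),
      newFirst g h φ ψ x v w = newFirst g h φ ψ x w v := fun x v w => by
    rw [hF.newFirst_apply, hF.newFirst_apply, hF.metric_symm x v, hF.tracelessShape_symm,
      hF.metric_symm x v]
  refine ⟨⟨⟨newFirst g h φ ψ, hsymm, hF.newFirst_pos hext, hbdd, hfirst⟩, rfl⟩,
    fun x v w => ?_, hsecond⟩
  rw [hF.newSecond_apply, hF.newSecond_apply, hF.metric_symm x v, hF.tracelessShape_symm,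
    hF.metric_symm x v]

/-- With `P = cosh φ + ψ S'`, the new forms are `I (P ·, ·)` and `I (P S' ·, ·)`, so the shape
operator of the new pair is again `S'`. -/
theorem IsFundamentalPair.shape_newPair (x : M) (v : TangentSpace (𝓡 2) x) :
    shape (newFirst g h φ ψ) (newSecond g h φ) x v = tracelessShape g h x v := by
  have hN := hF.newPair hext hφ hψ
  refine hN.metric_nondegenerate fun u => ?_
  rw [hN.apply_shape, hF.newSecond_apply, hF.newFirst_apply, hF.tracelessShape_tracelessShape,
    hF.skewCurv_mul_sinh hext]
  simp only [map_smul, smul_apply, smul_eq_mul]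
  ring

theorem IsFundamentalPair.meanCurv_newPair (x : M) :
    meanCurv (newFirst g h φ ψ) (newSecond g h φ) x = 0 := by
  rw [meanCurv, show shape (newFirst g h φ ψ) (newSecond g h φ) x = tracelessShape g h x from
    ContinuousLinearMap.ext (hF.shape_newPair hext hφ hψ x), (trace_det_tracelessShape g h x).1,
    zero_div]

theorem IsFundamentalPair.extCurv_newPair (x : M) :
    extCurv (newFirst g h φ ψ) (newSecond g h φ) x = -(meanCurv g h x ^ 2 - extCurv g h x) := by
  rw [extCurv, show shape (newFirst g h φ ψ) (newSecond g h φ) x = tracelessShape g h x from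
    ContinuousLinearMap.ext (hF.shape_newPair hext hφ hψ x), (trace_det_tracelessShape g h x).2]

end NewPair

/-! ### Levi-Civita connections and derivatives of tensor fields -/

/-- The Koszul equation has a bilinear solution `D`: a positive definite form `a` represents every
linear form. -/
theorem exists_koszul_tensor {E : Type*} [NormedAddCommGroup E] [NormedSpace ℝ E]
    [FiniteDimensional ℝ E] {a : E →L[ℝ] E →L[ℝ] ℝ} (hp : ∀ v, v ≠ 0 → 0 < a v v)
    (N : E →L[ℝ] E →L[ℝ] E →L[ℝ] ℝ) :
    ∃ D : E →L[ℝ] E →L[ℝ] E, ∀ y v z,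
      a (D y v) z = (N y z v + N v z y - N v y z) / 2 := by
  have hinj : Function.Injective (a : E →ₗ[ℝ] (E →L[ℝ] ℝ)) := by
    rw [injective_iff_map_eq_zero]
    intro u hu
    by_contra hu0
    have h1 := hp u hu0
    have h2 : a u = 0 := hu
    rw [h2] at h1
    simp at h1
  have hfr : Module.finrank ℝ E = Module.finrank ℝ (E →L[ℝ] ℝ) := by
    rw [(LinearMap.toContinuousLinearMap (𝕜 := ℝ) (E := E) (F' := ℝ)).symm.finrank_eq]
    exact (Subspace.dual_finrank_eq (K := ℝ) (V := E)).symm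
  have hsurj := (LinearMap.injective_iff_surjective_of_finrank_eq_finrank hfr).1 hinj
  have hex : ∀ y v, ∃ u, ∀ z, a u z = (N y z v + N v z y - N v y z) / 2 := by
    intro y v
    obtain ⟨u, hu⟩ := hsurj ((2 : ℝ)⁻¹ • ((N y).flip v + (N v).flip y - N v y))
    refine ⟨u, fun z => ?_⟩
    have h1 : a u = _ := hu
    rw [h1]
    simp only [sub_apply, add_apply, smul_apply, smul_eq_mul, ContinuousLinearMap.flip_apply]
    ring
  choose D hD using hex
  have hext : ∀ u w, (∀ z, a u z = a w z) → u = w := fun u w h =>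
    hinj (ContinuousLinearMap.ext h)
  have a1 : ∀ y y' z v, N (y + y') z v = N y z v + N y' z v := fun y y' z v => by
    rw [N.map_add]; rfl
  have a2 : ∀ y z z' v, N y (z + z') v = N y z v + N y z' v := fun y z z' v => by
    rw [(N y).map_add]; rfl
  have a3 : ∀ y z v v', N y z (v + v') = N y z v + N y z v' := fun y z => (N y z).map_add
  have s1 : ∀ (c : ℝ) y z v, N (c • y) z v = c * N y z v := fun c y z v => by
    rw [N.map_smul]; rfl
  have s2 : ∀ (c : ℝ) y z v, N y (c • z) v = c * N y z v := fun c y z v => by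
    rw [(N y).map_smul]; rfl
  have s3 : ∀ (c : ℝ) y z v, N y z (c • v) = c * N y z v := fun c y z => (N y z).map_smul c
  have b1 : ∀ u w z, a (u + w) z = a u z + a w z := fun u w z => by rw [a.map_add]; rfl
  have b2 : ∀ (c : ℝ) u z, a (c • u) z = c * a u z := fun c u z => by rw [a.map_smul]; rfl
  have hbil : IsBilinearMap ℝ (fun y v : E => D y v) :=
    { add_left := fun y y' v => hext _ _ fun u => by
        rw [b1, hD, hD, hD, a1, a2, a3]; ring
      smul_left := fun c y v => hext _ _ fun u => by
        rw [b2, hD, hD, s1, s2, s3]; ring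
      add_right := fun y v v' => hext _ _ fun u => by
        rw [b1, hD, hD, hD, a1 v v' u, a1 v v' y, a3]; ring
      smul_right := fun c y v => hext _ _ fun u => by
        rw [b2, hD, hD, s1 c v u, s1 c v y, s3]; ring }
  exact ⟨hbil.toLinearMap.toContinuousBilinearMap, hD⟩

section Connections

open Bundle Topology

variable {M : Type*} [TopologicalSpace M] [ChartedSpace Plane M] [IsManifold (𝓡 2) ∞ M]
  {cov : CovariantDerivative (𝓡 2) Plane (fun x : M => TangentSpace (𝓡 2) x)}

theorem cov_add {X Y : VecField M} {x : M} (hX : DiffVecAt X x) (hY : DiffVecAt Y x) :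
    cov (fun y => X y + Y y) x = cov X x + cov Y x :=
  cov.isCovariantDerivativeOnUniv.add hX hY

theorem cov_smul_apply {f : M → ℝ} {X : VecField M} {x : M}
    (hf : MDifferentiableAt (𝓡 2) 𝓘(ℝ, ℝ) f x) (hX : DiffVecAt X x) (v : TangentSpace (𝓡 2) x) :
    cov (fun y => f y • X y) x v = f x • cov X x v + mvfderiv (𝓡 2) f x v • X x := by
  have h : cov (f • X) x = _ := cov.isCovariantDerivativeOnUniv.leibniz hX hf
  change cov (f • X) x v = _
  rw [h]
  rfl

theorem cov_sub {X Y : VecField M} {x : M} (hX : DiffVecAt X x) (hY : DiffVecAt Y x) :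
    cov (fun y => X y - Y y) x = cov X x - cov Y x := by
  have h := cov_add (cov := cov) (hX.sub hY) hY
  simp only [sub_add_cancel] at h
  exact eq_sub_of_add_eq h.symm

theorem mlieBracket_eq (ht : cov.torsion = 0) {X Y : VecField M} {x : M}
    (hX : DiffVecAt X x) (hY : DiffVecAt Y x) :
    VectorField.mlieBracket (𝓡 2) X Y x = cov Y x (X x) - cov X x (Y x) :=
  (cov.torsion_eq_zero_iff.1 ht hX hY).symm

/-- The covariant derivative of a field `S` of endomorphisms is a tensor: its value
`N w v = (∇_v S) w` depends on the vectors `v, w` at `x` only. -/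
theorem exists_endoDeriv (cov : CovariantDerivative (𝓡 2) Plane (fun x : M => TangentSpace (𝓡 2) x))
    {S : EndoField M} {x : M}
    (hS : ∀ Y : VecField M, DiffVecAt Y x → DiffVecAt (fun y => S y (Y y)) x) :
    ∃ N : TangentSpace (𝓡 2) x →L[ℝ] TangentSpace (𝓡 2) x →L[ℝ] TangentSpace (𝓡 2) x,
      ∀ Y : VecField M, DiffVecAt Y x → ∀ v,
        cov (fun y => S y (Y y)) x v = N (Y x) v + S x (cov Y x v) := by
  have hΦ : TensorialAt (𝓡 2) Plane
      (fun Y : VecField M => cov (fun y => S y (Y y)) x - S x ∘L cov Y x) x := by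
    refine ⟨fun {f Y} hf hY => ?_, fun {Y Z} hY hZ => ?_⟩
    · ext1 v
      have h1 := cov_smul_apply (cov := cov) hf (hS Y hY) v
      have h2 := cov_smul_apply (cov := cov) hf hY v
      simp only [sub_apply, smul_apply, ContinuousLinearMap.comp_apply, Pi.smul_apply', map_smul]
      change cov _ x v - S x (cov (fun y => f y • Y y) x v) = _
      rw [h1, h2]
      simp only [map_add, map_smul]
      module
    · ext1 v
      have h1 := cov_add (cov := cov) (hS Y hY) (hS Z hZ)
      have h2 := cov_add (cov := cov) hY hZ
      simp only [sub_apply, add_apply, ContinuousLinearMap.comp_apply, Pi.add_apply, map_add]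
      change cov _ x v - S x (cov (fun y => Y y + Z y) x v) = _
      rw [h1, h2]
      simp only [add_apply, map_add]
      module
  refine ⟨TensorialAt.mkHom _ x hΦ, fun Y hY v => ?_⟩
  rw [TensorialAt.mkHom_apply hΦ hY]
  simp

/-- The Codazzi equation at a point is the symmetry of the tensor `(v, w) ↦ (∇_v S) w`. -/
theorem codazzi_iff [T2Space M] (ht : cov.torsion = 0) {S : EndoField M} {x : M}
    {N : TangentSpace (𝓡 2) x →L[ℝ] TangentSpace (𝓡 2) x →L[ℝ] TangentSpace (𝓡 2) x}
    (hN : ∀ Y : VecField M, DiffVecAt Y x → ∀ v,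
      cov (fun y => S y (Y y)) x v = N (Y x) v + S x (cov Y x v)) :
    (∀ X Y : VecField M, SmoothVec X → SmoothVec Y →
      cov (fun y => S y (Y y)) x (X x) - cov (fun y => S y (X y)) x (Y x)
        - S x (VectorField.mlieBracket (𝓡 2) X Y x) = 0) ↔ ∀ v w, N w v = N v w := by
  have key : ∀ X Y : VecField M, SmoothVec X → SmoothVec Y →
      cov (fun y => S y (Y y)) x (X x) - cov (fun y => S y (X y)) x (Y x)
        - S x (VectorField.mlieBracket (𝓡 2) X Y x) = N (Y x) (X x) - N (X x) (Y x) := by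
    intro X Y hX hY
    rw [hN Y (hY.diffVecAt x), hN X (hX.diffVecAt x),
      mlieBracket_eq ht (hX.diffVecAt x) (hY.diffVecAt x), map_sub]
    abel
  constructor
  · intro h v w
    obtain ⟨X, hX, rfl⟩ := exists_smoothVec v
    obtain ⟨Y, hY, rfl⟩ := exists_smoothVec w
    rw [← sub_eq_zero, ← key X Y hX hY]
    exact h X Y hX hY
  · intro h X Y hX hY
    rw [key X Y hX hY, h, sub_self]

variable {A B : BilinField M} (hAB : IsFundamentalPair A B)

include hAB

/-- The covariant derivative of the metric `A` for an arbitrary connection is a tensor, with value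
`N y z v = (∇_v A) (y, z)`. -/
theorem IsFundamentalPair.exists_metricDeriv
    (cov : CovariantDerivative (𝓡 2) Plane (fun x : M => TangentSpace (𝓡 2) x)) (x : M) :
    ∃ N : TangentSpace (𝓡 2) x →L[ℝ] TangentSpace (𝓡 2) x →L[ℝ] TangentSpace (𝓡 2) x →L[ℝ] ℝ,
      ∀ Y Z : VecField M, DiffVecAt Y x → DiffVecAt Z x → ∀ v,
        mvfderiv (𝓡 2) (fun y => A y (Y y) (Z y)) x v =
          N (Y x) (Z x) v + A x (cov Y x v) (Z x) + A x (Y x) (cov Z x v) := by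
  have hA := hAB.metric_smooth
  let Φ : VecField M → VecField M → TangentSpace (𝓡 2) x →L[ℝ] ℝ := fun Y Z =>
    mvfderiv (𝓡 2) (fun y => A y (Y y) (Z y)) x - A x (Z x) ∘L cov Y x - A x (Y x) ∘L cov Z x
  have hsymm : ∀ Y Z, Φ Y Z = Φ Z Y := fun Y Z => by
    simp only [Φ, hAB.metric_symm _ (Y _) (Z _)]
    abel
  have hΦ : ∀ Z, DiffVecAt Z x → TensorialAt (𝓡 2) Plane (fun Y => Φ Y Z) x := by
    refine fun Z hZ => ⟨fun {f Y} hf hY => ?_, fun {Y W} hY hW => ?_⟩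
    · ext1 v
      have h2 := cov_smul_apply (cov := cov) hf hY v
      have h3 := mvfderiv_fun_mul hf (hA.mdifferentiableAt hY hZ)
      simp only [Φ, sub_apply, smul_apply, ContinuousLinearMap.comp_apply, Pi.smul_apply',
        map_smul, smul_eq_mul]
      change _ - A x (Z x) (cov (fun y => f y • Y y) x v) - _ = _
      rw [h2, h3]
      simp only [map_add, map_smul, add_apply, smul_apply, smul_eq_mul, hAB.metric_symm x (Z x)]
      ring
    · ext1 v
      have h2 := cov_add (cov := cov) hY hW
      have h3 := mvfderiv_fun_add (hA.mdifferentiableAt hY hZ) (hA.mdifferentiableAt hW hZ)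
      simp only [Φ, sub_apply, add_apply, ContinuousLinearMap.comp_apply, Pi.add_apply, map_add]
      change _ - A x (Z x) (cov (fun y => Y y + W y) x v) - _ = _
      rw [h2, h3]
      simp only [map_add, add_apply]
      ring
  have hΦ' : ∀ Y, DiffVecAt Y x → TensorialAt (𝓡 2) Plane (Φ Y) x := fun Y hY => by
    convert hΦ Y hY using 1
    ext1 Z
    exact hsymm Y Z
  refine ⟨TensorialAt.mkHom₂ Φ x hΦ hΦ', fun Y Z hY hZ v => ?_⟩
  rw [TensorialAt.mkHom₂_apply hΦ hΦ' hY hZ]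
  simp only [Φ, sub_apply, ContinuousLinearMap.comp_apply, hAB.metric_symm x (Z x)]
  ring

/-- The Levi-Civita connection of `A` exists as soon as there is some torsion free connection `∇`:
it is `∇ + D`, where `D` is given by the Koszul formula
`2 A (D (v, y), z) = (∇_v A) (y, z) + (∇_y A) (v, z) - (∇_z A) (v, y)`. -/
theorem IsFundamentalPair.exists_isLeviCivita (ht : cov.torsion = 0) :
    ∃ cov' : CovariantDerivative (𝓡 2) Plane (fun x : M => TangentSpace (𝓡 2) x),
      IsLeviCivita A cov' := by
  choose N hN using hAB.exists_metricDeriv cov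
  have hsymm : ∀ x y z v, N x y z v = N x z y v := by
    intro x y z v
    have h1 := hN x _ _ (diffVecAt_extend y) (diffVecAt_extend z) v
    have h2 := hN x _ _ (diffVecAt_extend z) (diffVecAt_extend y) v
    simp only [FiberBundle.extend_apply_self] at h1 h2
    simp only [hAB.metric_symm _ (FiberBundle.extend Plane z _)] at h2
    rw [h1] at h2
    rw [hAB.metric_symm x z, hAB.metric_symm x _ y] at h2
    linarith
  have hex : ∀ x : M,
      ∃ D : TangentSpace (𝓡 2) x →L[ℝ] TangentSpace (𝓡 2) x →L[ℝ] TangentSpace (𝓡 2) x,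
        ∀ y v z, A x (D y v) z = (N x y z v + N x v z y - N x v y z) / 2 :=
    fun x => exists_koszul_tensor (E := Plane) (hAB.metric_pos x) (N x)
  choose D hD using hex
  have hE' : ∀ (Y : VecField M) x v, (cov.addOneForm D) Y x v = cov Y x v + D x (Y x) v :=
    fun _ _ _ => rfl
  refine ⟨cov.addOneForm D, ⟨?_, fun Y Z x v hY hZ => ?_⟩⟩
  · rw [CovariantDerivative.torsion_eq_zero_iff]
    intro X Y x hX hY
    rw [mlieBracket_eq ht hX hY, hE', hE']
    have : D x (Y x) (X x) = D x (X x) (Y x) := hAB.metric_nondegenerate fun u => by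
      rw [hD, hD, hsymm x (X x) (Y x)]
      ring
    rw [this]
    abel
  · rw [hN x Y Z hY hZ v, hE', hE', map_add, map_add, add_apply, hAB.metric_symm x (Y x) (D _ _ _),
      hD, hD, hsymm x v (Z x), hsymm x v (Y x), hsymm x (Z x) (Y x)]
    ring

end Connections

/-! ### The Codazzi equation of the new pair -/

section Codazzi

open Bundle Topology

variable {M : Type*} [TopologicalSpace M] [ChartedSpace Plane M] [IsManifold (𝓡 2) ∞ M]

theorem mvfderiv_congr {F : Type*} [NormedAddCommGroup F] [NormedSpace ℝ F] {f f' : M → F} {x : M}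
    (h : f =ᶠ[𝓝 x] f') : mvfderiv (𝓡 2) f x = mvfderiv (𝓡 2) f' x := by
  simp only [mvfderiv]
  rw [h.mfderiv_eq]
  rfl

theorem mvfderiv_comp_real {F : ℝ → ℝ} {F' : ℝ} {f : M → ℝ} {x : M} (hF : HasDerivAt F F' (f x))
    (hf : MDifferentiableAt (𝓡 2) 𝓘(ℝ, ℝ) f x) (v : TangentSpace (𝓡 2) x) :
    mvfderiv (𝓡 2) (fun y => F (f y)) x v = F' * mvfderiv (𝓡 2) f x v := by
  have h1 : HasMFDerivAt 𝓘(ℝ, ℝ) 𝓘(ℝ, ℝ) F (f x) (ContinuousLinearMap.toSpanSingleton ℝ F') :=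
    hF.hasFDerivAt.hasMFDerivAt
  have h2 := (h1.comp x hf.hasMFDerivAt).mfderiv
  exact (DFunLike.congr_fun h2 v).trans (mul_comm (mvfderiv (𝓡 2) f x v) F')

/-- Two torsion free connections differ by a symmetric tensor. -/
theorem exists_symm_difference
    {cov cov' : CovariantDerivative (𝓡 2) Plane (fun x : M => TangentSpace (𝓡 2) x)}
    (ht : cov.torsion = 0) (ht' : cov'.torsion = 0) (x : M) :
    ∃ D : TangentSpace (𝓡 2) x →L[ℝ] TangentSpace (𝓡 2) x →L[ℝ] TangentSpace (𝓡 2) x,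
      (∀ Y : VecField M, DiffVecAt Y x → ∀ v, cov' Y x v = cov Y x v + D (Y x) v) ∧
      ∀ v w, D v w = D w v := by
  have hD : ∀ Y : VecField M, DiffVecAt Y x → ∀ v,
      cov' Y x v = cov Y x v + (cov'.difference cov x) (Y x) v := by
    intro Y hY v
    have h1 : cov'.difference cov x (Y x) v = (cov' Y x - cov Y x) v := DFunLike.congr_fun
      (IsCovariantDerivativeOn.difference_apply cov'.isCovariantDerivativeOnUniv
        cov.isCovariantDerivativeOnUniv (Set.mem_univ x) hY) v
    rw [h1, sub_apply, add_sub_cancel]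
  refine ⟨cov'.difference cov x, hD, fun v w => ?_⟩
  have hv := diffVecAt_extend v
  have hw := diffVecAt_extend w
  have h1 := mlieBracket_eq ht hv hw
  rw [mlieBracket_eq ht' hv hw, hD _ hv, hD _ hw] at h1
  simp only [FiberBundle.extend_apply_self] at h1
  have h2 := sub_eq_zero.2 h1
  rw [eq_comm, ← sub_eq_zero, ← h2]
  abel

/-- A bilinear map on a plane is symmetric if it is so on a basis. -/
theorem symm_of_pair {V : Type*} [AddCommGroup V] [Module ℝ V] [TopologicalSpace V]
    [IsTopologicalAddGroup V] [ContinuousConstSMul ℝ V]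
    (hV : Module.finrank ℝ V = 2) {N : V →L[ℝ] V →L[ℝ] V} {v₀ w₀ : V}
    (hi : LinearIndependent ℝ ![v₀, w₀]) (h : N v₀ w₀ = N w₀ v₀) (v w : V) : N v w = N w v := by
  obtain ⟨a, b, rfl⟩ := exists_eq_smul_add_smul hV hi v
  obtain ⟨c, d, rfl⟩ := exists_eq_smul_add_smul hV hi w
  simp only [map_add, map_smul, add_apply, smul_apply, h]
  module

variable {g h : BilinField M} (hF : IsFundamentalPair g h)

include hF

theorem IsFundamentalPair.diffVecAt_tracelessShape {Y : VecField M} {x : M}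
    (hY : DiffVecAt Y x) : DiffVecAt (fun y => tracelessShape g h y (Y y)) x :=
  (hF.diffVecAt_shape hF.smooth hY).sub
    (DiffVecAt.smul ((hF.contMDiff_meanCurv hF.smooth x).mdifferentiableAt (by simp)) hY)

theorem IsFundamentalPair.mdifferentiableAt_skewCurv {x : M} (hx : skewCurv g h x ≠ 0) :
    MDifferentiableAt (𝓡 2) 𝓘(ℝ, ℝ) (skewCurv g h) x := by
  have h1 : ContMDiffAt (𝓡 2) 𝓘(ℝ, ℝ) ∞ (fun y => meanCurv g h y ^ 2 - extCurv g h y) x :=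
    ((hF.contMDiff_meanCurv hF.smooth x).pow 2).sub (hF.contMDiff_extCurv hF.smooth x)
  have h2 : meanCurv g h x ^ 2 - extCurv g h x ≠ 0 := by
    rw [← hF.skewCurv_sq]
    exact pow_ne_zero 2 hx
  exact ((Real.contDiffAt_sqrt (n := ∞) h2).contMDiffAt.comp x h1).mdifferentiableAt (by simp)

variable {cov cov' : CovariantDerivative (𝓡 2) Plane (fun x : M => TangentSpace (𝓡 2) x)}

/-- The Codazzi equation of `(g, h)` expresses the skew part of `∇' S'`, for a second torsion free
connection `∇' = ∇ + D`, through `dH` and `D`. -/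
theorem IsFundamentalPair.skew_endoDeriv_tracelessShape [T2Space M] (ht : cov.torsion = 0) {x : M}
    (hC : ∀ X Y : VecField M, SmoothVec X → SmoothVec Y →
      cov (fun y => shape g h y (Y y)) x (X x) - cov (fun y => shape g h y (X y)) x (Y x)
        - shape g h x (VectorField.mlieBracket (𝓡 2) X Y x) = 0)
    {D N : TangentSpace (𝓡 2) x →L[ℝ] TangentSpace (𝓡 2) x →L[ℝ] TangentSpace (𝓡 2) x}
    (hD : ∀ Y : VecField M, DiffVecAt Y x → ∀ v, cov' Y x v = cov Y x v + D (Y x) v)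
    (hN : ∀ Y : VecField M, DiffVecAt Y x → ∀ v,
      cov' (fun y => tracelessShape g h y (Y y)) x v
        = N (Y x) v + tracelessShape g h x (cov' Y x v))
    (v w : TangentSpace (𝓡 2) x) :
    N w v - N v w = D (tracelessShape g h x w) v - D (tracelessShape g h x v) w
      - (tracelessShape g h x (D w v) - tracelessShape g h x (D v w))
      - (mvfderiv (𝓡 2) (meanCurv g h) x v • w - mvfderiv (𝓡 2) (meanCurv g h) x w • v) := by
  obtain ⟨G, hG⟩ := exists_endoDeriv cov (S := shape g h) (x := x)
    (fun Y hY => hF.diffVecAt_shape hF.smooth hY)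
  have hGs := (codazzi_iff ht hG).1 hC
  have hH : MDifferentiableAt (𝓡 2) 𝓘(ℝ, ℝ) (meanCurv g h) x :=
    (hF.contMDiff_meanCurv hF.smooth x).mdifferentiableAt (by simp)
  have key : ∀ v w, N w v = G w v - mvfderiv (𝓡 2) (meanCurv g h) x v • w
      + D (tracelessShape g h x w) v - tracelessShape g h x (D w v) := by
    intro v w
    have hw := diffVecAt_extend w
    have h1 := hN _ hw v
    rw [hD _ (hF.diffVecAt_tracelessShape hw), hD _ hw] at h1
    have h2 : cov (fun y => tracelessShape g h y (FiberBundle.extend Plane w y)) x v =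
        cov (fun y => shape g h y (FiberBundle.extend Plane w y)) x v
          - cov (fun y => meanCurv g h y • FiberBundle.extend Plane w y) x v :=
      DFunLike.congr_fun
        (cov_sub (cov := cov) (hF.diffVecAt_shape hF.smooth hw) (DiffVecAt.smul hH hw)) v
    rw [h2, hG _ hw, cov_smul_apply hH hw] at h1
    simp only [FiberBundle.extend_apply_self, map_add] at h1
    rw [eq_sub_of_add_eq h1.symm, tracelessShape_apply g h x (cov _ x v)]
    module
  rw [key v w, key w v, hGs v w]
  module

variable {φ ψ : M → ℝ}
  (hext : ∀ x, skewCurv g h x ≠ 0 → ψ x = Real.sinh (φ x) / skewCurv g h x)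

include hext

/-- On the eigenspace of `S'` for the eigenvalue `ε q`, where `ε = ± 1` and `q = √(H² - K)`, the
new metric is `e^{ε φ} g`. -/
theorem IsFundamentalPair.newFirst_apply_eigenvector {ε : ℝ} (hε : ε = 1 ∨ ε = -1) {x : M}
    (hx : skewCurv g h x ≠ 0) {w : TangentSpace (𝓡 2) x}
    (hw : tracelessShape g h x w = (ε * skewCurv g h x) • w) (u : TangentSpace (𝓡 2) x) :
    newFirst g h φ ψ x u w = Real.exp (ε * φ x) * g x u w := by
  rw [hF.newFirst_apply, hF.tracelessShape_symm, hw, map_smul, smul_eq_mul, hext x hx]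
  have : Real.exp (ε * φ x) = Real.cosh (φ x) + ε * Real.sinh (φ x) := by
    rcases hε with rfl | rfl
    · rw [one_mul, one_mul, Real.cosh_add_sinh]
    · rw [neg_one_mul, neg_one_mul, ← sub_eq_add_neg, Real.cosh_sub_sinh]
  rw [this]
  field_simp

/-- The difference `D` of the Levi-Civita connections of the new metric and of `g` on an
eigenvector of `S'`. -/
theorem IsFundamentalPair.newFirst_difference_eigenvector
    (hφ : ContMDiff (𝓡 2) 𝓘(ℝ, ℝ) ∞ φ) (hcov : IsLeviCivita g cov)
    (hcov' : IsLeviCivita (newFirst g h φ ψ) cov') {x : M}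
    {D : TangentSpace (𝓡 2) x →L[ℝ] TangentSpace (𝓡 2) x →L[ℝ] TangentSpace (𝓡 2) x}
    (hD : ∀ Y : VecField M, DiffVecAt Y x → ∀ v, cov' Y x v = cov Y x v + D (Y x) v)
    (hx : skewCurv g h x ≠ 0) {ε : ℝ} (hε : ε = 1 ∨ ε = -1) {w : TangentSpace (𝓡 2) x}
    (hw : tracelessShape g h x w = (ε * skewCurv g h x) • w) (v : TangentSpace (𝓡 2) x) :
    newFirst g h φ ψ x (D w v) w
      = ε / 2 * mvfderiv (𝓡 2) φ x v * newFirst g h φ ψ x w w := by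
  have hε2 : ε * ε = 1 := by rcases hε with rfl | rfl <;> norm_num
  have hε0 : ε ≠ 0 := by rintro rfl; simp at hε2
  have hqd := hF.mdifferentiableAt_skewCurv hx
  have hφd : MDifferentiableAt (𝓡 2) 𝓘(ℝ, ℝ) φ x := (hφ x).mdifferentiableAt (by simp)
  -- Extend `w` to a field `W` of eigenvectors, by projecting an arbitrary extension.
  set Y : VecField M := FiberBundle.extend Plane ((2 * ε * skewCurv g h x)⁻¹ • w) with hYdef
  have hY : DiffVecAt Y x := diffVecAt_extend _
  set W : VecField M := fun y => tracelessShape g h y (Y y) + (ε * skewCurv g h y) • Y y with hWdef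
  have hεq : MDifferentiableAt (𝓡 2) 𝓘(ℝ, ℝ) (fun y => ε * skewCurv g h y) x :=
    mdifferentiableAt_const.mul hqd
  have hW : DiffVecAt W x := (hF.diffVecAt_tracelessShape hY).add (DiffVecAt.smul hεq hY)
  have hWx : W x = w := by
    simp only [hWdef, hYdef, FiberBundle.extend_apply_self, map_smul, hw, smul_smul, ← add_smul]
    convert one_smul ℝ w
    field_simp
    norm_num
  have hWe : ∀ y, tracelessShape g h y (W y) = (ε * skewCurv g h y) • W y := by
    intro y
    simp only [hWdef, map_add, map_smul, hF.tracelessShape_tracelessShape, smul_add, smul_smul]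
    rw [show ε * skewCurv g h y * (ε * skewCurv g h y) = ε * ε * skewCurv g h y ^ 2 by ring, hε2,
      one_mul, add_comm]
  have hev : (fun y => newFirst g h φ ψ y (W y) (W y)) =ᶠ[𝓝 x]
      fun y => Real.exp (ε * φ y) * g y (W y) (W y) := by
    filter_upwards [hqd.continuousAt.eventually_ne hx] with y hy
    exact hF.newFirst_apply_eigenvector hext hε hy (hWe y) (W y)
  have hexp : MDifferentiableAt (𝓡 2) 𝓘(ℝ, ℝ) (fun y => Real.exp (ε * φ y)) x :=
    (Real.contDiff_exp.contMDiff.comp (contMDiff_const.mul hφ) x).mdifferentiableAt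
      (n := ∞) (by simp)
  have h1 := hcov'.metric W W x v hW hW
  have h2 := hcov.metric W W x v hW hW
  have h3 : mvfderiv (𝓡 2) (fun y => Real.exp (ε * φ y)) x v
      = ε * Real.exp (ε * φ x) * mvfderiv (𝓡 2) φ x v := by
    refine mvfderiv_comp_real (F := fun t => Real.exp (ε * t)) ?_ hφd v
    have := ((hasDerivAt_id' (φ x)).const_mul ε).exp
    convert this using 1
    ring
  have hA : ∀ u, newFirst g h φ ψ x u w = Real.exp (ε * φ x) * g x u w := fun u =>
    hF.newFirst_apply_eigenvector hext hε hx hw u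
  have hsym : newFirst g h φ ψ x w (cov' W x v) = newFirst g h φ ψ x (cov' W x v) w := by
    rw [hF.newFirst_apply, hF.newFirst_apply, hF.metric_symm x w, hF.tracelessShape_symm x w,
      hF.metric_symm x w]
  rw [mvfderiv_congr hev, mvfderiv_fun_mul hexp (hF.metric_smooth.mdifferentiableAt hW hW)] at h1
  simp only [add_apply, smul_apply, smul_eq_mul] at h1
  rw [h2, h3, hWx, hsym, hF.metric_symm x w, hA, hD W hW, hWx, map_add, add_apply] at h1
  rw [hA, hA]
  linear_combination (-1 / 2) * h1

end Codazzi

section CodazziNewPair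

variable {M : Type*} [TopologicalSpace M] [ChartedSpace Plane M] [IsManifold (𝓡 2) ∞ M]

/-- Away from umbilics the shape operator has a basis of principal directions. -/
theorem IsFundamentalPair.exists_eigenvectors {g h : BilinField M} (hF : IsFundamentalPair g h)
    {x : M} (hx : skewCurv g h x ≠ 0) :
    ∃ w₁ w₂ : TangentSpace (𝓡 2) x,
      tracelessShape g h x w₁ = ((1 : ℝ) * skewCurv g h x) • w₁ ∧
      tracelessShape g h x w₂ = ((-1 : ℝ) * skewCurv g h x) • w₂ ∧
      w₁ ≠ 0 ∧ w₂ ≠ 0 ∧ g x w₁ w₂ = 0 := by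
  have htr := (trace_det_tracelessShape g h x).1
  obtain ⟨u₁, h₁⟩ := exists_apply_add_smul_ne_zero (finrank_tangentSpace x) htr hx
  obtain ⟨u₂, h₂⟩ := exists_apply_add_smul_ne_zero (finrank_tangentSpace x) htr (neg_ne_zero.2 hx)
  have e₁ : tracelessShape g h x (tracelessShape g h x u₁ + skewCurv g h x • u₁)
      = ((1 : ℝ) * skewCurv g h x) • (tracelessShape g h x u₁ + skewCurv g h x • u₁) := by
    rw [map_add, map_smul, hF.tracelessShape_tracelessShape]
    module
  have e₂ : tracelessShape g h x (tracelessShape g h x u₂ + (-skewCurv g h x) • u₂)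
      = ((-1 : ℝ) * skewCurv g h x) • (tracelessShape g h x u₂ + (-skewCurv g h x) • u₂) := by
    rw [map_add, map_smul, hF.tracelessShape_tracelessShape]
    module
  refine ⟨_, _, e₁, e₂, h₁, h₂, ?_⟩
  have h3 := hF.tracelessShape_symm x (tracelessShape g h x u₁ + skewCurv g h x • u₁)
    (tracelessShape g h x u₂ + (-skewCurv g h x) • u₂)
  rw [e₁, e₂, map_smul, map_smul, smul_apply, smul_eq_mul, smul_eq_mul] at h3
  have h4 : (2 * skewCurv g h x) * g x (tracelessShape g h x u₁ + skewCurv g h x • u₁)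
      (tracelessShape g h x u₂ + (-skewCurv g h x) • u₂) = 0 := by linear_combination h3
  exact (mul_eq_zero.1 h4).resolve_left (mul_ne_zero two_ne_zero hx)

variable [T2Space M] {g h : BilinField M} (hF : IsFundamentalPair g h)
  {cov cov' : CovariantDerivative (𝓡 2) Plane (fun x : M => TangentSpace (𝓡 2) x)}
  {φ ψ : M → ℝ}

include hF

/-- At each point, the Codazzi equation of `S'` for the Levi-Civita connection of the new metric is
the equation `dH = √(H² - K) dφ`. Umbilics need no limiting argument: there `S' = 0`, and both
sides say that `dH = 0`. -/
theorem IsFundamentalPair.symm_endoDeriv_newPair_iff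
    (hext : ∀ x, skewCurv g h x ≠ 0 → ψ x = Real.sinh (φ x) / skewCurv g h x)
    (hφ : ContMDiff (𝓡 2) 𝓘(ℝ, ℝ) ∞ φ) (hψ : ContMDiff (𝓡 2) 𝓘(ℝ, ℝ) ∞ ψ)
    (hcov : IsLeviCivita g cov) (hcov' : IsLeviCivita (newFirst g h φ ψ) cov') {x : M}
    (hC : ∀ X Y : VecField M, SmoothVec X → SmoothVec Y →
      cov (fun y => shape g h y (Y y)) x (X x) - cov (fun y => shape g h y (X y)) x (Y x)
        - shape g h x (VectorField.mlieBracket (𝓡 2) X Y x) = 0)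
    {N : TangentSpace (𝓡 2) x →L[ℝ] TangentSpace (𝓡 2) x →L[ℝ] TangentSpace (𝓡 2) x}
    (hN : ∀ Y : VecField M, DiffVecAt Y x → ∀ v,
      cov' (fun y => tracelessShape g h y (Y y)) x v
        = N (Y x) v + tracelessShape g h x (cov' Y x v)) :
    (∀ v w, N w v = N v w) ↔
      mvfderiv (𝓡 2) (meanCurv g h) x - skewCurv g h x • mvfderiv (𝓡 2) φ x = 0 := by
  have hV := finrank_tangentSpace x
  obtain ⟨D, hD, hDs⟩ := exists_symm_difference hcov.torsion_eq_zero hcov'.torsion_eq_zero x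
  have key := hF.skew_endoDeriv_tracelessShape hcov.torsion_eq_zero hC hD hN
  -- On a basis, both conditions say that the 1-form `θ = dH - q dφ` vanishes.
  suffices hsuff : ∃ w₁ w₂ : TangentSpace (𝓡 2) x, LinearIndependent ℝ ![w₁, w₂] ∧
      N w₂ w₁ - N w₁ w₂ =
        (mvfderiv (𝓡 2) (meanCurv g h) x - skewCurv g h x • mvfderiv (𝓡 2) φ x) w₂ • w₁
        - (mvfderiv (𝓡 2) (meanCurv g h) x - skewCurv g h x • mvfderiv (𝓡 2) φ x) w₁ • w₂ by
    obtain ⟨w₁, w₂, hi, hw⟩ := hsuff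
    constructor
    · intro hs
      rw [hs, sub_self, sub_eq_add_neg, ← neg_smul] at hw
      obtain ⟨h1, h2⟩ := LinearIndependent.pair_iff.1 hi _ _ hw.symm
      ext u
      obtain ⟨a, b, rfl⟩ := exists_eq_smul_add_smul hV hi u
      rw [map_add, map_smul, map_smul, h1, neg_eq_zero.1 h2]
      simp
    · intro h0
      rw [h0] at hw
      simp only [zero_apply, zero_smul, sub_self] at hw
      exact fun v w => symm_of_pair hV hi (sub_eq_zero.1 hw).symm w v
  by_cases hx : skewCurv g h x = 0
  · obtain ⟨w₁, w₂, hi⟩ := exists_linearIndependent_pair hV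
    refine ⟨w₁, w₂, hi, ?_⟩
    rw [key w₁ w₂]
    simp only [hF.tracelessShape_eq_zero hx, hx, map_zero, zero_apply, zero_smul, sub_zero]
    abel
  · obtain ⟨w₁, w₂, e₁, e₂, hw₁, hw₂, ho⟩ := hF.exists_eigenvectors hx
    have hN' := hF.newPair hext hφ hψ
    have hi := linearIndependent_of_orthogonal (hF.metric_symm x) (hF.metric_pos x) hw₁ hw₂ ho
    refine ⟨w₁, w₂, hi, ?_⟩
    -- The components of `D (w₁, w₂)` come from the derivatives of the lengths of `w₁` and `w₂`.
    have ho' : newFirst g h φ ψ x w₁ w₂ = 0 := by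
      rw [hF.newFirst_apply_eigenvector hext (Or.inr rfl) hx e₂, ho, mul_zero]
    have d₁ := hF.newFirst_difference_eigenvector hext hφ hcov hcov' hD hx (Or.inl rfl) e₁ w₂
    have d₂ := hF.newFirst_difference_eigenvector hext hφ hcov hcov' hD hx (Or.inr rfl) e₂ w₁
    obtain ⟨s, t, hst⟩ := exists_eq_smul_add_smul hV hi (D w₁ w₂)
    rw [hDs w₂ w₁] at d₂
    rw [hst] at d₁ d₂
    simp only [map_add, map_smul, add_apply, smul_apply, smul_eq_mul, ho',
      hN'.metric_symm x w₂ w₁, mul_zero, add_zero, zero_add] at d₁ d₂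
    have hs := mul_right_cancel₀ (hN'.metric_pos x w₁ hw₁).ne' d₁
    have ht := mul_right_cancel₀ (hN'.metric_pos x w₂ hw₂).ne' d₂
    rw [key w₁ w₂, e₁, e₂]
    simp only [map_smul, smul_apply, sub_apply, hDs w₂ w₁, hst, hs, ht, sub_self, smul_eq_mul]
    module

end CodazziNewPair

/-! ### The Hopf differential -/

section Hopf

open Topology

variable {M : Type*} [TopologicalSpace M] [ChartedSpace Plane M] [IsManifold (𝓡 2) ∞ M]

theorem mvfderiv_complex {f k : M → ℝ} {x : M} (hf : MDifferentiableAt (𝓡 2) 𝓘(ℝ, ℝ) f x)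
    (hk : MDifferentiableAt (𝓡 2) 𝓘(ℝ, ℝ) k x) (v : TangentSpace (𝓡 2) x) :
    mvfderiv (𝓡 2) (fun y => ((f y : ℂ) - Complex.I * (k y : ℂ)) / 2) x v =
      ((mvfderiv (𝓡 2) f x v : ℂ) - Complex.I * (mvfderiv (𝓡 2) k x v : ℂ)) / 2 := by
  have key : ∀ (L : ℝ →L[ℝ] ℂ) {u : M → ℝ}, MDifferentiableAt (𝓡 2) 𝓘(ℝ, ℝ) u x →
      MDifferentiableAt (𝓡 2) 𝓘(ℝ, ℂ) (fun y => L (u y)) x ∧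
      mvfderiv (𝓡 2) (fun y => L (u y)) x v = L (mvfderiv (𝓡 2) u x v) := by
    intro L u hu
    have h1 : HasMFDerivAt 𝓘(ℝ, ℝ) 𝓘(ℝ, ℂ) L (u x) L := L.hasFDerivAt.hasMFDerivAt
    have h2 := h1.comp x hu.hasMFDerivAt
    exact ⟨h2.mdifferentiableAt, DFunLike.congr_fun h2.mfderiv v⟩
  obtain ⟨h1, e1⟩ := key (((1 : ℂ) / 2) • Complex.ofRealCLM) hf
  obtain ⟨h2, e2⟩ := key ((Complex.I / 2) • Complex.ofRealCLM) hk
  have h3 : (fun y => ((f y : ℂ) - Complex.I * (k y : ℂ)) / 2) =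
      fun y => (((1 : ℂ) / 2) • Complex.ofRealCLM) (f y)
        - ((Complex.I / 2) • Complex.ofRealCLM) (k y) := by
    ext1 y
    simp only [smul_apply, Complex.ofRealCLM_apply, smul_eq_mul]
    ring
  rw [h3, mvfderiv_fun_sub h1 h2, sub_apply, e1, e2]
  simp only [smul_apply, Complex.ofRealCLM_apply, smul_eq_mul]
  ring

variable {A B : BilinField M} (hAB : IsFundamentalPair A B) (o : SurfaceOrientation M)

include hAB

theorem IsFundamentalPair.complexStructure_sq (x : M) (v : TangentSpace (𝓡 2) x) :
    complexStructure o A x (complexStructure o A x v) = -v :=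
  (hAB.complexStructure_rotation o x v).1

theorem IsFundamentalPair.complexStructure_orthogonal (x : M) (v : TangentSpace (𝓡 2) x) :
    A x v (complexStructure o A x v) = 0 :=
  (hAB.complexStructure_rotation o x v).2.1

theorem IsFundamentalPair.complexStructure_skew (x : M) (v w : TangentSpace (𝓡 2) x) :
    A x (complexStructure o A x v) w = -A x v (complexStructure o A x w) := by
  have h := hAB.complexStructure_orthogonal o x (v + w)
  simp only [map_add, add_apply, hAB.complexStructure_orthogonal o x] at h
  rw [hAB.metric_symm x _ w]
  linarith

theorem IsFundamentalPair.linearIndependent_complexStructure {x : M} {v : TangentSpace (𝓡 2) x}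
    (hv : v ≠ 0) : LinearIndependent ℝ ![v, complexStructure o A x v] := by
  refine linearIndependent_of_orthogonal (hAB.metric_symm x) (hAB.metric_pos x) hv (fun h => hv ?_)
    (hAB.complexStructure_orthogonal o x v)
  have := hAB.complexStructure_sq o x v
  rw [h, map_zero, eq_comm, neg_eq_zero] at this
  exact this

theorem IsFundamentalPair.diffVecAt_complexStructure {Y : VecField M} {x : M}
    (hY : DiffVecAt Y x) : DiffVecAt (fun y => complexStructure o A y (Y y)) x := by
  have hpos : extCurv A o.form x ≠ 0 :=
    (rotation_aux (A := A x) (C := o.form x) (R := shape A o.form x) (hAB.metric_symm x)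
      (hAB.metric_pos x) (o.alternating x) (o.ne_zero x) (hAB.apply_shape o.form x)).1.ne'
  have h1 := (Real.contDiffAt_sqrt (n := ∞) hpos).contMDiffAt.comp x
    (hAB.contMDiff_extCurv o.smooth x)
  have h2 : ContMDiffAt (𝓡 2) 𝓘(ℝ, ℝ) ∞ (fun y => (√(extCurv A o.form y))⁻¹) x := by
    refine ContMDiffAt.inv₀ h1 (Real.sqrt_ne_zero'.2 ?_)
    exact (rotation_aux (A := A x) (C := o.form x) (R := shape A o.form x) (hAB.metric_symm x)
      (hAB.metric_pos x) (o.alternating x) (o.ne_zero x) (hAB.apply_shape o.form x)).1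
  exact DiffVecAt.smul (h2.mdifferentiableAt (by simp)) (hAB.diffVecAt_shape o.smooth hY)

variable {cov : CovariantDerivative (𝓡 2) Plane (fun x : M => TangentSpace (𝓡 2) x)}

/-- The complex structure is parallel: `∇_v J` is skew, hence maps `w` to a multiple of `J w`, and
it anticommutes with `J`, so that this multiple vanishes. -/
theorem IsFundamentalPair.cov_complexStructure (hcov : IsLeviCivita A cov) {Y : VecField M} {x : M}
    (hY : DiffVecAt Y x) (v : TangentSpace (𝓡 2) x) :
    cov (fun y => complexStructure o A y (Y y)) x v = complexStructure o A x (cov Y x v) := by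
  obtain ⟨K, hK⟩ := exists_endoDeriv cov (S := complexStructure o A) (x := x)
    (fun Y hY => hAB.diffVecAt_complexStructure o hY)
  have hanti : ∀ w, K (complexStructure o A x w) v = -complexStructure o A x (K w v) := by
    intro w
    have hw := diffVecAt_extend w
    have h1 := hK _ (hAB.diffVecAt_complexStructure o hw) v
    rw [hK _ hw] at h1
    have h2 : (fun y => complexStructure o A y (complexStructure o A y
        (FiberBundle.extend Plane w y))) = fun y => (-1 : ℝ) • FiberBundle.extend Plane w y := by
      ext1 y
      rw [hAB.complexStructure_sq, neg_one_smul]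
    rw [h2, cov_smul_apply mdifferentiableAt_const hw, mvfderiv_const] at h1
    simp only [FiberBundle.extend_apply_self, map_add, hAB.complexStructure_sq, zero_apply,
      zero_smul, add_zero, neg_one_smul] at h1
    rw [eq_neg_iff_add_eq_zero]
    have := sub_eq_zero.2 h1.symm
    rw [← this]
    abel
  have hskew : ∀ w z, A x (K w v) z = -A x w (K z v) := by
    intro w z
    have hw := diffVecAt_extend w
    have hz := diffVecAt_extend z
    have hJw := hAB.diffVecAt_complexStructure o hw
    have hJz := hAB.diffVecAt_complexStructure o hz
    have h1 := hcov.metric _ _ x v hJw hz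
    have h2 := hcov.metric _ _ x v hw hJz
    simp only [hAB.complexStructure_skew o _ (FiberBundle.extend Plane w _)] at h1
    rw [mvfderiv_fun_neg, neg_apply, h2, hK _ hw, hK _ hz] at h1
    simp only [FiberBundle.extend_apply_self, map_add, add_apply,
      hAB.complexStructure_skew o x (cov _ x v)] at h1
    linarith
  have hzero : ∀ w, K w v = 0 := by
    intro w
    by_cases hw : w = 0
    · rw [hw, map_zero, zero_apply]
    have h1 : A x (K w v) w = 0 := by
      have := hskew w w
      rw [hAB.metric_symm x w] at this
      linarith
    have h2 : A x (K w v) (complexStructure o A x w) = 0 := by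
      have h3 := hskew w (complexStructure o A x w)
      rw [hanti, map_neg, neg_neg, hAB.metric_symm x w, hAB.complexStructure_skew] at h3
      linarith
    refine hAB.metric_nondegenerate fun u => ?_
    obtain ⟨s, t, rfl⟩ := exists_eq_smul_add_smul (finrank_tangentSpace x)
      (hAB.linearIndependent_complexStructure o hw) u
    rw [map_add, map_smul, map_smul, h1, h2]
    simp
  rw [hK Y hY v, hzero, zero_add]

variable (hH : ∀ x, meanCurv A B x = 0)

include hH

theorem IsFundamentalPair.shape_complexStructure (x : M) (v : TangentSpace (𝓡 2) x) :
    shape A B x (complexStructure o A x v) = -complexStructure o A x (shape A B x v) := by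
  refine apply_rotation (finrank_tangentSpace x) (hAB.metric_symm x) (hAB.metric_pos x) ?_ ?_
    (hAB.complexStructure_sq o x) (hAB.complexStructure_orthogonal o x) v
  · intro v w
    rw [hAB.apply_shape, hAB.metric_symm x v, hAB.apply_shape, hAB.symm]
  · have := hH x
    rw [meanCurv] at this
    linarith

theorem IsFundamentalPair.apply_complexStructure_left (x : M) (v w : TangentSpace (𝓡 2) x) :
    B x (complexStructure o A x v) w = B x v (complexStructure o A x w) := by
  rw [← hAB.apply_shape, hAB.shape_complexStructure o hH, map_neg, neg_apply,
    hAB.complexStructure_skew, neg_neg, hAB.apply_shape]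

theorem IsFundamentalPair.hopfDifferential_eq (x : M) (v w : TangentSpace (𝓡 2) x) :
    hopfDifferential o A B x v w =
      ((B x v w : ℂ) - Complex.I * (B x (complexStructure o A x v) w : ℂ)) / 2 := by
  have h2 : B x (complexStructure o A x v) (complexStructure o A x w) = -B x v w := by
    rw [hAB.apply_complexStructure_left o hH, hAB.complexStructure_sq, map_neg]
  rw [hopfDifferential, twoZeroPart, h2, ← hAB.apply_complexStructure_left o hH]
  push_cast
  ring

/-- The Dolbeault derivative of the Hopf differential in terms of the tensor
`N w v = (∇_v S) w`. -/
theorem IsFundamentalPair.dbar_hopfDifferential (hcov : IsLeviCivita A cov) {x : M}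
    {N : TangentSpace (𝓡 2) x →L[ℝ] TangentSpace (𝓡 2) x →L[ℝ] TangentSpace (𝓡 2) x}
    (hN : ∀ Y : VecField M, DiffVecAt Y x → ∀ v,
      cov (fun y => shape A B y (Y y)) x v = N (Y x) v + shape A B x (cov Y x v))
    {X Y Z : VecField M} (hX : DiffVecAt X x) (hY : DiffVecAt Y x) (hZ : DiffVecAt Z x) :
    dbar (complexStructure o A) (hopfDifferential o A B) X Y Z x =
      ((A x (N (Y x) (X x) + N (complexStructure o A x (Y x)) (complexStructure o A x (X x)))
          (Z x) : ℝ) +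
        Complex.I * (A x (N (Y x) (complexStructure o A x (X x))
          - N (complexStructure o A x (Y x)) (X x)) (Z x) : ℝ)) / 4 := by
  have hB : ∀ Y : VecField M, DiffVecAt Y x → ∀ v,
      mvfderiv (𝓡 2) (fun y => B y (Y y) (Z y)) x v =
        A x (N (Y x) v) (Z x) + B x (cov Y x v) (Z x) + B x (Y x) (cov Z x v) := by
    intro Y hY v
    have h1 := hcov.metric _ _ x v (hAB.diffVecAt_shape hAB.smooth hY) hZ
    simp only [hAB.apply_shape] at h1
    rw [h1, hN Y hY, map_add, add_apply, hAB.apply_shape]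
  have hJY := hAB.diffVecAt_complexStructure o hY
  have hlie : ∀ V : VecField M, DiffVecAt V x → lieDeriv (hopfDifferential o A B) V Y Z x =
      ((A x (N (Y x) (V x)) (Z x) : ℂ)
        - Complex.I * (A x (N (complexStructure o A x (Y x)) (V x)) (Z x) : ℂ)) / 2
      + hopfDifferential o A B x (cov V x (Y x)) (Z x)
      + hopfDifferential o A B x (Y x) (cov V x (Z x)) := by
    intro V hV
    rw [lieDeriv, mlieBracket_eq hcov.torsion_eq_zero hV hY,
      mlieBracket_eq hcov.torsion_eq_zero hV hZ]
    simp only [hAB.hopfDifferential_eq o hH]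
    rw [mvfderiv_complex (hAB.smooth.mdifferentiableAt hY hZ) (hAB.smooth.mdifferentiableAt hJY hZ),
      hB Y hY, hB _ hJY, hAB.cov_complexStructure o hcov hY]
    simp only [map_sub, sub_apply]
    push_cast
    ring
  have hq1 : ∀ v w, hopfDifferential o A B x (complexStructure o A x v) w
      = Complex.I * hopfDifferential o A B x v w := by
    intro v w
    simp only [hAB.hopfDifferential_eq o hH, hAB.complexStructure_sq, map_neg, neg_apply]
    push_cast
    linear_combination ((B x (complexStructure o A x v) w : ℂ) / 2) * Complex.I_mul_I
  have hq2 : ∀ v w, hopfDifferential o A B x v (complexStructure o A x w)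
      = Complex.I * hopfDifferential o A B x v w := by
    intro v w
    rw [← hq1]
    simp only [hAB.hopfDifferential_eq o hH, hAB.apply_complexStructure_left o hH]
  rw [dbar, hlie X hX, hlie _ (hAB.diffVecAt_complexStructure o hX),
    hAB.cov_complexStructure o hcov hX, hAB.cov_complexStructure o hcov hX, hq1, hq2]
  simp only [map_add, map_sub, add_apply, sub_apply]
  push_cast
  linear_combination ((hopfDifferential o A B x (cov X x (Y x)) (Z x)
    + hopfDifferential o A B x (Y x) (cov X x (Z x))) / 2
    - (A x (N (complexStructure o A x (Y x)) (complexStructure o A x (X x))) (Z x) : ℂ) / 4)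
    * Complex.I_mul_I

theorem IsFundamentalPair.endoDeriv_complexStructure (hcov : IsLeviCivita A cov) {x : M}
    {N : TangentSpace (𝓡 2) x →L[ℝ] TangentSpace (𝓡 2) x →L[ℝ] TangentSpace (𝓡 2) x}
    (hN : ∀ Y : VecField M, DiffVecAt Y x → ∀ v,
      cov (fun y => shape A B y (Y y)) x v = N (Y x) v + shape A B x (cov Y x v))
    (v w : TangentSpace (𝓡 2) x) :
    N (complexStructure o A x w) v = -complexStructure o A x (N w v) := by
  have hw := diffVecAt_extend w
  have hS := hAB.diffVecAt_shape hAB.smooth hw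
  have h1 := hN _ (hAB.diffVecAt_complexStructure o hw) v
  have h2 : (fun y => shape A B y (complexStructure o A y (FiberBundle.extend Plane w y))) =
      fun y => (-1 : ℝ) • complexStructure o A y (shape A B y (FiberBundle.extend Plane w y)) := by
    ext1 y
    rw [hAB.shape_complexStructure o hH, neg_one_smul]
  rw [h2, cov_smul_apply mdifferentiableAt_const (hAB.diffVecAt_complexStructure o hS),
    mvfderiv_const, hAB.cov_complexStructure o hcov hS, hAB.cov_complexStructure o hcov hw,
    hN _ hw, hAB.shape_complexStructure o hH] at h1
  simp only [FiberBundle.extend_apply_self, map_add, zero_apply, zero_smul, add_zero, neg_one_smul,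
    neg_add] at h1
  exact (add_right_cancel h1).symm

/-- For vanishing mean curvature, the Hopf differential is holomorphic at a point if and only if
the Codazzi equation holds there. -/
theorem IsFundamentalPair.dbar_hopfDifferential_eq_zero_iff [T2Space M] (hcov : IsLeviCivita A cov)
    {x : M} {N : TangentSpace (𝓡 2) x →L[ℝ] TangentSpace (𝓡 2) x →L[ℝ] TangentSpace (𝓡 2) x}
    (hN : ∀ Y : VecField M, DiffVecAt Y x → ∀ v,
      cov (fun y => shape A B y (Y y)) x v = N (Y x) v + shape A B x (cov Y x v)) :
    (∀ X Y Z : VecField M, SmoothVec X → SmoothVec Y → SmoothVec Z →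
      dbar (complexStructure o A) (hopfDifferential o A B) X Y Z x = 0) ↔
    ∀ v w, N w v = N v w := by
  have hJ := hAB.endoDeriv_complexStructure o hH hcov hN
  constructor
  · intro h
    have hE : ∀ v w, N w (complexStructure o A x v) = N (complexStructure o A x w) v := by
      intro v w
      refine hAB.metric_nondegenerate fun u => ?_
      obtain ⟨X, hX, rfl⟩ := exists_smoothVec v
      obtain ⟨Y, hY, rfl⟩ := exists_smoothVec w
      obtain ⟨Z, hZ, rfl⟩ := exists_smoothVec u
      have h1 := h X Y Z hX hY hZ
      rw [hAB.dbar_hopfDifferential o hH hcov hN (hX.diffVecAt x) (hY.diffVecAt x)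
        (hZ.diffVecAt x), div_eq_zero_iff] at h1
      have h2 := congrArg Complex.im (h1.resolve_right (by norm_num))
      simp only [Complex.add_im, Complex.ofReal_im, Complex.mul_im, Complex.I_re, Complex.I_im,
        Complex.ofReal_re, Complex.zero_im, zero_mul, one_mul, zero_add, map_sub, sub_apply] at h2
      linarith
    obtain ⟨v₀, w₀, hi⟩ := exists_linearIndependent_pair (finrank_tangentSpace x)
    have hv₀ : v₀ ≠ 0 := hi.ne_zero 0
    exact fun v w => symm_of_pair (finrank_tangentSpace x)
      (hAB.linearIndependent_complexStructure o hv₀) (hE v₀ v₀) w v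
  · intro h X Y Z hX hY hZ
    have hE : ∀ v w, N w (complexStructure o A x v) = N (complexStructure o A x w) v := by
      intro v w
      rw [hJ v w, ← h, hJ w v, h]
    rw [hAB.dbar_hopfDifferential o hH hcov hN (hX.diffVecAt x) (hY.diffVecAt x)
      (hZ.diffVecAt x), hE, hE, hAB.complexStructure_sq]
    simp

end Hopf

end CodazziPairs

theorem mainTheorem6 {M : Type*} [TopologicalSpace M] [T2Space M] [SecondCountableTopology M]
    [ChartedSpace CodazziPairs.Plane M] [IsManifold (𝓡 2) ∞ M]
    (o : CodazziPairs.SurfaceOrientation M) (g h : CodazziPairs.BilinField M)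
    (hgh : CodazziPairs.IsCodazziPair g h) (φ ψ : M → ℝ)
    (hφ : ContMDiff (𝓡 2) 𝓘(ℝ, ℝ) ∞ φ) (hψ : ContMDiff (𝓡 2) 𝓘(ℝ, ℝ) ∞ ψ)
    (hext : ∀ x, CodazziPairs.skewCurv g h x ≠ 0 →
      ψ x = Real.sinh (φ x) / CodazziPairs.skewCurv g h x)
    (A B : CodazziPairs.BilinField M) (hA : A = CodazziPairs.newFirst g h φ ψ)
    (hB : B = CodazziPairs.newSecond g h φ) :
    CodazziPairs.IsFundamentalPair A B ∧
    (∀ x, CodazziPairs.meanCurv A B x = 0) ∧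
    (∀ x, CodazziPairs.extCurv A B x
      = -(CodazziPairs.meanCurv g h x ^ 2 - CodazziPairs.extCurv g h x)) ∧
    List.TFAE [
      CodazziPairs.IsCodazziPair A B,
      CodazziPairs.IsHolomorphicQuadratic (CodazziPairs.complexStructure o A)
        (CodazziPairs.hopfDifferential o A B),
      ∀ x, mvfderiv (𝓡 2) (CodazziPairs.meanCurv g h) x
        - CodazziPairs.skewCurv g h x • mvfderiv (𝓡 2) φ x = 0] := by
  subst hA hB
  obtain ⟨hF, cov, hcov, hC⟩ := hgh
  have hN := hF.newPair hext hφ hψ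
  have hH := hF.meanCurv_newPair hext hφ hψ
  refine ⟨hN, hH, hF.extCurv_newPair hext hφ hψ, ?_⟩
  have hS : CodazziPairs.shape (CodazziPairs.newFirst g h φ ψ) (CodazziPairs.newSecond g h φ)
      = CodazziPairs.tracelessShape g h := by
    ext1 x
    exact ContinuousLinearMap.ext (hF.shape_newPair hext hφ hψ x)
  -- All three conditions are pointwise, and are compared through the tensor `∇' S'` for any
  -- Levi-Civita connection `∇'` of the new metric.
  have hCod : ∀ cov', CodazziPairs.IsLeviCivita (CodazziPairs.newFirst g h φ ψ) cov' → ∀ x,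
      (∀ X Y : CodazziPairs.VecField M, CodazziPairs.SmoothVec X → CodazziPairs.SmoothVec Y →
        cov' (fun y => CodazziPairs.shape (CodazziPairs.newFirst g h φ ψ)
            (CodazziPairs.newSecond g h φ) y (Y y)) x (X x)
          - cov' (fun y => CodazziPairs.shape (CodazziPairs.newFirst g h φ ψ)
            (CodazziPairs.newSecond g h φ) y (X y)) x (Y x)
          - CodazziPairs.shape (CodazziPairs.newFirst g h φ ψ) (CodazziPairs.newSecond g h φ) x
            (VectorField.mlieBracket (𝓡 2) X Y x) = 0) ↔
      mvfderiv (𝓡 2) (CodazziPairs.meanCurv g h) x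
        - CodazziPairs.skewCurv g h x • mvfderiv (𝓡 2) φ x = 0 := by
    intro cov' hcov' x
    obtain ⟨N, hNx⟩ := CodazziPairs.exists_endoDeriv cov' (S := CodazziPairs.tracelessShape g h)
      (x := x) (fun Y hY => hF.diffVecAt_tracelessShape hY)
    rw [hS, CodazziPairs.codazzi_iff hcov'.torsion_eq_zero hNx]
    exact hF.symm_endoDeriv_newPair_iff hext hφ hψ hcov hcov'
      (fun X Y hX hY => hC X Y hX hY x) hNx
  obtain ⟨cov', hcov'⟩ := hN.exists_isLeviCivita hcov.torsion_eq_zero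
  tfae_have 1 ↔ 3 := by
    constructor
    · rintro ⟨-, cov'', hcov'', h1⟩ x
      exact (hCod cov'' hcov'' x).1 fun X Y hX hY => h1 X Y hX hY x
    · intro h3
      exact ⟨hN, cov', hcov', fun X Y hX hY x => (hCod cov' hcov' x).2 (h3 x) X Y hX hY⟩
  tfae_have 2 ↔ 3 := by
    have hhol : ∀ x, (∀ X Y Z : CodazziPairs.VecField M, CodazziPairs.SmoothVec X →
        CodazziPairs.SmoothVec Y → CodazziPairs.SmoothVec Z →
        CodazziPairs.dbar (CodazziPairs.complexStructure o (CodazziPairs.newFirst g h φ ψ))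
          (CodazziPairs.hopfDifferential o (CodazziPairs.newFirst g h φ ψ)
            (CodazziPairs.newSecond g h φ)) X Y Z x = 0) ↔
        mvfderiv (𝓡 2) (CodazziPairs.meanCurv g h) x
          - CodazziPairs.skewCurv g h x • mvfderiv (𝓡 2) φ x = 0 := by
      intro x
      obtain ⟨N, hNx⟩ := CodazziPairs.exists_endoDeriv cov' (x := x)
        (fun Y hY => hN.diffVecAt_shape hN.smooth hY)
      rw [← hCod cov' hcov' x, CodazziPairs.codazzi_iff hcov'.torsion_eq_zero hNx]
      exact hN.dbar_hopfDifferential_eq_zero_iff o hH hcov' hNx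
    constructor
    · exact fun h2 x => (hhol x).1 fun X Y Z hX hY hZ => h2 X Y Z hX hY hZ x
    · exact fun h3 X Y Z hX hY hZ x => (hhol x).2 (h3 x) X Y Z hX hY hZ
  tfae_finish
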